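/- **Destruction of the condensate in the bulk II.** *Bulk.* Let $d>0$, $\Omega=\{(x,y)\in[0,\infty)^2 : |x-y|\le d\}$ and, for $L>0$, $\Omega_L=\{(x,y)\in\Omega : x,y\le L\}$. Let $H_p$ be the self-adjoint operator $-\partial_x^2-\partial_y^2$ on the antisymmetric functions in $L^2(\Omega)$, with Dirichlet conditions on $|x-y|=d$ and, on the part of the boundary where $x=0$ or $y=0$, either Dirichlet or Neumann conditions (the result holds for each choice). Let $H_p^L$ be the same operator on $\Omega_L$, with Dirichlet conditions also where $x=L$ or $y=L$; its eigenvalues, counted with multiplicity, are $E_0(L)\le E_1(L)\le\dots$, with eigenfunctions $\varphi_0,\varphi_1,\dots$. Put $E_0:=\inf\sigma(H_p)$. *Surface.* Let $(e_i)$ be non-negative edge weights, $n(L)\in\{1,2,\dots\}$ the number of surface defects up to length $L$, and $\lambda_j(L)$, $1\le j\le n(L)$, the eigenvalues of the weighted (non-negative) graph Laplacian $(\mathcal L f)(i)=\sum_m\gamma_{im}(f(i)-f(m))$ of the path graph on $n(L)$ vertices, where $\gamma_{i,i+1}=\gamma_{i+1,i}=e_i$ and all other $\gamma_{im}$ vanish.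 *Mean-field model.* Let $\beta,\lambda,\rho>0$ and $\alpha\ge0$. Along a sequence $L=L_k\to\infty$ let real numbers $\mu_L$ (chemical potential) and $\rho_s(L)$ (surface density) satisfy $$\mu_L<\min\{\lambda\rho_s(L)-\alpha,\;E_0(L)\},\qquad \rho_s(L)=\frac1{n(L)}\sum_{j=1}^{n(L)}\frac1{e^{\beta(\lambda_j(L)-\alpha+\lambda\rho_s(L)-\mu_L)}-1},$$ $$\lim_{L\to\infty}\frac1L\Bigg(\sum_{j=1}^{n(L)}\frac1{e^{\beta(\lambda_j(L)-\alpha+\lambda\rho_s(L)-\mu_L)}-1}+\sum_{n=0}^\infty\frac1{e^{\beta(E_n(L)-\mu_L)}-1}\Bigg)=\rho .$$ Assume that $L/n(L)\to\delta\in[0,\infty)$ and $\mu_L\to\mu\in[-\infty,\infty]$ along this sequence. Let $$\rho_{exc}(\beta,\mu)=\frac{\sqrt2}{\pi}\sum_{n=1}^\infty\int_0^\infty\frac{dx}{e^{2\pi^2n^2\beta/d^2}\,e^{\beta(x^2-\mu)}-1}\in[0,\infty],\qquad \rho_{exc}(\beta,-\infty)=0 .$$ *Claim.* In the case of Dirichlet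 conditions where $x=0$ or $y=0$, one has $E_0=2\pi^2/d^2$. For either choice of the conditions there, if $$\delta\,\bigl(\rho-\rho_{exc}(\beta,\mu)\bigr)<\frac{E_0+\alpha}{\nu\lambda}\quad\text{for some }\nu>1$$ (with $0\cdot(-\infty)=0$), then $\mu<E_0-\varepsilon$ for some $\varepsilon>0$, and no bulk state is macroscopically occupied: $$\lim_{L\to\infty}\frac1L\,\frac1{e^{\beta(E_n(L)-\mu_L)}-1}=0\qquad\text{for all } n\in\{0,1,2,\dots\}.$$ -/

import Mathlib

open MeasureTheory Filter Topology
open scoped ENNReal ContDiff ComplexConjugate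

noncomputable section

namespace PairModel

/-! ### The one-pair Hamiltonian in the bulk -/

/-- The condition imposed on the pair wave function at the end point of the half-line, that is, on
the part of the boundary of the configuration space where one of the two coordinates is `0`. -/
inductive EdgeCondition
  | dirichlet
  | neumann

/-- The two-particle configuration space `Ω` on the half-line. -/
def config (d : ℝ) : Set (ℝ × ℝ) :=
  {p | 0 ≤ p.1 ∧ 0 ≤ p.2 ∧ |p.1 - p.2| ≤ d}

/-- The two-particle configuration space `Ω_L` on the interval `[0, L]`. -/
def configBox (d L : ℝ) : Set (ℝ × ℝ) :=
  {p | p ∈ config d ∧ p.1 ≤ L ∧ p.2 ≤ L}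

/-- An open set that keeps supports away from the coordinate axes exactly in the Dirichlet case. -/
def EdgeCondition.region : EdgeCondition → Set (ℝ × ℝ)
  | .dirichlet => {p | 0 < p.1 ∧ 0 < p.2}
  | .neumann => Set.univ

/-- Where the core functions for `Ω` may live: away from the hard wall `|x - y| = d`. -/
def support (edge : EdgeCondition) (d : ℝ) : Set (ℝ × ℝ) :=
  {p | |p.1 - p.2| < d} ∩ edge.region

/-- Where the core functions for `Ω_L` may live: away from the hard wall `|x - y| = d` and from the
right end point `L` of the wire (Dirichlet conditions there). -/
def supportBox (edge : EdgeCondition) (d L : ℝ) : Set (ℝ × ℝ) :=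
  support edge d ∩ {p | p.1 < L ∧ p.2 < L}

/-- Antisymmetric smooth functions on the plane with compact support inside `U`. Their restrictions
to the configuration space form the core of the quadratic form. -/
def IsCore (U : Set (ℝ × ℝ)) (u : ℝ × ℝ → ℂ) : Prop :=
  ContDiff ℝ ∞ u ∧ HasCompactSupport u ∧ tsupport u ⊆ U ∧ ∀ x y, u (x, y) = -u (y, x)

/-- The partial derivative in the first variable. -/
def dx (u : ℝ × ℝ → ℂ) (p : ℝ × ℝ) : ℂ := fderiv ℝ u p (1, 0)

/-- The partial derivative in the second variable. -/
def dy (u : ℝ × ℝ → ℂ) (p : ℝ × ℝ) : ℂ := fderiv ℝ u p (0, 1)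

/-- `u` lies in the domain of the closure of the form `∫_Ω |∇u|²`, defined on the core functions
with support in `U`, and `(g, h)` is its gradient. -/
def HasFormGradient (Ω U : Set (ℝ × ℝ)) (u g h : Lp ℂ 2 (volume.restrict Ω)) : Prop :=
  ∃ w : ℕ → ℝ × ℝ → ℂ, (∀ k, IsCore U (w k)) ∧
    Tendsto (fun k => eLpNorm (fun p => w k p - u p) 2 (volume.restrict Ω)) atTop (𝓝 0) ∧
    Tendsto (fun k => eLpNorm (fun p => dx (w k) p - g p) 2 (volume.restrict Ω)) atTop (𝓝 0) ∧
    Tendsto (fun k => eLpNorm (fun p => dy (w k) p - h p) 2 (volume.restrict Ω)) atTop (𝓝 0)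

/-- `H u = e u` for the self-adjoint operator `H` of the closed form: `u` lies in the form domain
and `⟨∇v, ∇u⟩ = e ⟨v, u⟩` for all `v` in the core. (The zero vector is allowed.) -/
def IsEigenvector (Ω U : Set (ℝ × ℝ)) (e : ℝ) (u : Lp ℂ 2 (volume.restrict Ω)) : Prop :=
  ∃ g h : Lp ℂ 2 (volume.restrict Ω), HasFormGradient Ω U u g h ∧
    ∀ v, IsCore U v →
      ∫ p in Ω, (conj (dx v p) * g p + conj (dy v p) * h p) = (e : ℂ) * ∫ p in Ω, conj (v p) * u p

/-- The eigenvalue `E_n(L)`, `n = 0, 1, 2, …`, of the pair Hamiltonian on `Ω_L`, in increasing order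
and counted with multiplicity: the least `E` such that there are `n + 1` orthonormal eigenfunctions
with eigenvalues at most `E`. -/
def pairLevel (edge : EdgeCondition) (d L : ℝ) (n : ℕ) : ℝ :=
  sInf {E : ℝ | ∃ f : Fin (n + 1) → Lp ℂ 2 (volume.restrict (configBox d L)),
    Orthonormal ℂ f ∧
      ∀ i, ∃ e ≤ E, IsEigenvector (configBox d L) (supportBox edge d L) e (f i)}

/-- `E_0`, the bottom of the spectrum of the pair Hamiltonian on the half-line: the infimum of the
quadratic form over normalised functions of its core. -/
def bottomEnergy (edge : EdgeCondition) (d : ℝ) : ℝ :=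
  sInf {E : ℝ | ∃ u, IsCore (support edge d) u ∧ ∫ p in config d, ‖u p‖ ^ 2 = 1 ∧
    E = ∫ p in config d, (‖dx u p‖ ^ 2 + ‖dy u p‖ ^ 2)}

/-! ### The surface defects -/

/-- Edge weights of the path graph on `n` vertices: `e i` joins the vertices `i` and `i + 1`. -/
def pathWeight (e : ℕ → ℝ) {n : ℕ} (i j : Fin n) : ℝ :=
  if (i : ℕ) + 1 = j ∨ (j : ℕ) + 1 = i then e (min (i : ℕ) (j : ℕ)) else 0

/-- The weighted (positive) graph Laplacian of the path graph on `n` vertices,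
`f ↦ (i ↦ ∑ j, γ i j * (f i - f j))`. -/
def pathLaplacian (e : ℕ → ℝ) (n : ℕ) : Matrix (Fin n) (Fin n) ℂ :=
  Matrix.of fun i j =>
    (((if i = j then ∑ m, pathWeight e i m else 0) - pathWeight e i j : ℝ) : ℂ)

theorem pathWeight_comm (e : ℕ → ℝ) {n : ℕ} (i j : Fin n) :
    pathWeight e i j = pathWeight e j i := by
  simp only [pathWeight, min_comm (i : ℕ) (j : ℕ), or_comm (a := (i : ℕ) + 1 = j)]

theorem pathLaplacian_isHermitian (e : ℕ → ℝ) (n : ℕ) : (pathLaplacian e n).IsHermitian := by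
  ext i j
  simp only [pathLaplacian, Matrix.conjTranspose_apply, Matrix.of_apply, Complex.star_def,
    Complex.conj_ofReal, pathWeight_comm e j i]
  by_cases h : i = j
  · subst h; rfl
  · rw [if_neg h, if_neg (Ne.symm h)]

/-- The eigenvalues of the graph Laplacian on `n` defects, counted with multiplicity. -/
def surfaceLevel (e : ℕ → ℝ) (n : ℕ) : Fin n → ℝ := (pathLaplacian_isHermitian e n).eigenvalues

/-! ### Occupation numbers and densities -/

/-- The grand canonical occupation of a one-pair state of energy `E`. -/
def occupation (β E μ : ℝ) : ℝ := 1 / (Real.exp (β * (E - μ)) - 1)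

/-- The effective energy of the `j`-th surface state in the mean-field model with surface tension
`α`, interaction strength `lam` and surface density `ρs`. -/
def meanFieldLevel (e : ℕ → ℝ) (n : ℕ) (α lam ρs : ℝ) (j : Fin n) : ℝ :=
  surfaceLevel e n j - α + lam * ρs

/-- The density of pairs (bulk and surface) per unit length, for `n` defects and wire length `L`. -/
def totalDensity (edge : EdgeCondition) (d : ℝ) (e : ℕ → ℝ) (β α lam : ℝ) (L : ℝ) (n : ℕ)
    (μ ρs : ℝ) : ℝ≥0∞ :=
  ((∑ j, ENNReal.ofReal (occupation β (meanFieldLevel e n α lam ρs j) μ)) +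
    ∑' m, ENNReal.ofReal (occupation β (pairLevel edge d L m) μ)) / ENNReal.ofReal L

/-- `(√2/π) ∑_{n ≥ 1} ∫_0^∞ dx / (exp(β 2π²n²/d²) exp(β(x² - μ)) - 1)`, with the value `0` at
`μ = -∞`. -/
def excitedDensity (β d : ℝ) (μ : EReal) : ℝ≥0∞ :=
  if μ = ⊥ then 0 else
    ENNReal.ofReal (√2 / Real.pi) * ∑' n : ℕ, ∫⁻ x in Set.Ioi (0 : ℝ), ENNReal.ofReal
      (1 / (Real.exp (β * (2 * Real.pi ^ 2 * ((n : ℝ) + 1) ^ 2 / d ^ 2)) *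
        Real.exp (β * (x ^ 2 - μ.toReal)) - 1))

end PairModel

end

/-!
The chemical potential is bounded in two ways by hypothesis: by the lowest pair level and by
`λ ρ_s - α`. The proof turns the second bound into a gap below `E_0`.

*Gap.* By the self-consistency condition the surface carries `n(L) ρ_s(L) / L` particles per unit
length, and surface and bulk together carry `ρ` in the limit. If the bulk carries at least
`ρ_exc(β, μ)`, then `limsup ρ_s ≤ δ (ρ - ρ_exc)`, which the hypothesis puts below
`(E_0 + α) / (ν λ)` (`eventually_surfaceDensity_lt`). Hence
`μ ≤ (E_0 + α) / ν - α = E_0 - (1 - 1 / ν) (E_0 + α)`, and `E_0 > 0` (`bottomEnergy_pos`) makes this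
a strict inequality. Every level satisfies `E_n(L) ≥ E_0` (`bottomEnergy_le_pairLevel`), so all
occupation numbers stay bounded and vanish after division by `L`.

*Bulk density.* The products of odd Dirichlet modes of `x - y` on `(-d, d)` and Dirichlet modes of
`x + y` on `(d, 2L - d)` live on a rectangle inside `Ω_L`; they are orthogonal in `L²` and for the
form, with energies `2π²n²/d² + π²k²/(2(L - d)²)`. By the min-max principle
(`exists_eigenvectors_box`) they dominate the levels `E_m(L)` one by one, so the bulk density is at
least a Riemann sum for `ρ_exc`, and Fatou's lemma gives `excitedDensity_le_liminf`.

*Spectral theory.* The form domain is the closure of the graph of the gradient on the core, a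
Hilbert space `formGraph`. Its embedding `J` into `L²(Ω_L)` is compact
(`isCompactOperator_formEmbedding`): on the square `(0, L]²`, where a core function vanishes off
`Ω_L`, Poincaré's inequality on a fine grid approximates it by step functions. The eigenvectors of
`J† J` with eigenvalue `c` are the eigenfunctions of the pair Hamiltonian with energy `1 / c - 1`,
which yields both the existence of the levels and the min-max bound
(`exists_orthonormal_eigenvectors`).

*The bottom of the spectrum.* An antisymmetric function vanishes on the diagonal. With Dirichlet
conditions, Wirtinger's inequality on the segments of the lines `x + y = s` between
`x - y = 0` and `x - y = ± d` gives `E_0 ≥ 2π²/d²`; the trial functions give the reverse inequality.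
With Neumann conditions, a cruder estimate on horizontal lines still gives `E_0 ≥ 1/(4d²)`.
-/

namespace PairModel

/-! ### Compact operators and the min-max principle -/

section MinMax

open Module.End

variable {G H : Type*} [NormedAddCommGroup G] [InnerProductSpace ℂ G]
  [NormedAddCommGroup H] [InnerProductSpace ℂ H] [CompleteSpace H]

/-- The norm of a non-negative compact operator is an eigenvalue, and it bounds every
Rayleigh quotient: were it in the resolvent set, the quotients would stay away from it. -/
theorem exists_eigenvector_of_le_rayleigh [CompleteSpace G] {T : G →L[ℂ] G}
    (hT : IsCompactOperator T) (hsymm : T.IsSymmetric) (hpos : ∀ x, 0 ≤ (inner ℂ (T x) x).re) {κ : ℝ} (hκ : 0 < κ) {x : G}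
    (hx : x ≠ 0) (hxκ : κ * ‖x‖ ^ 2 ≤ (inner ℂ (T x) x).re) :
    ∃ c : ℝ, κ ≤ c ∧ ∃ y : G, y ≠ 0 ∧ T y = (c : ℂ) • y := by
  have hxn : 0 < ‖x‖ := norm_pos_iff.2 hx
  have hnt : Nontrivial G := ⟨x, 0, hx⟩
  have hle : κ ≤ ‖T‖ := by
    have h1 : (inner ℂ (T x) x).re ≤ ‖T‖ * ‖x‖ ^ 2 := by
      calc (inner ℂ (T x) x).re ≤ ‖inner ℂ (T x) x‖ := Complex.re_le_norm _
        _ ≤ ‖T x‖ * ‖x‖ := norm_inner_le_norm _ _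
        _ ≤ ‖T‖ * ‖x‖ * ‖x‖ := by gcongr; exact T.le_opNorm x
        _ = _ := by ring
    exact le_of_mul_le_mul_right (hxκ.trans h1) (by positivity)
  have hspec : ((‖T‖ : ℝ) : ℂ) ∈ spectrum ℂ T := by
    by_contra hcon
    obtain ⟨ε, hε, hR⟩ := T.rayleighQuotient_le_of_norm_mem_resolventSet
      (by simpa [spectrum] using hcon)
    have habs : ‖T‖ ≤ ‖T‖ - ε := by
      conv_lhs => rw [T.norm_eq_iSup_rayleighQuotient hsymm]
      refine ciSup_le fun y => ?_
      rw [abs_of_nonneg]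
      · exact hR y
      · rw [ContinuousLinearMap.rayleighQuotient, ContinuousLinearMap.reApplyInnerSelf_apply]
        exact div_nonneg (hpos y) (by positivity)
    linarith
  have hne : ((‖T‖ : ℝ) : ℂ) ≠ 0 := by
    simpa using (norm_pos_iff.1 (hκ.trans_le hle))
  obtain ⟨y, hy⟩ := ((hT.hasEigenvalue_iff_mem_spectrum hne).2 hspec).exists_hasEigenvector
  exact ⟨‖T‖, hle, y, hy.2, by simpa using hy.apply_eq_smul⟩

/-- The min-max principle for a compact embedding `J` of a form domain `G` into `H`: if
`κ ‖x‖² ≤ ‖J x‖²` on an `m`-dimensional subspace, then `J† J` has `m` eigenvectors with eigenvalue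
at least `κ`, and their images under `J` are orthonormal. -/
theorem exists_orthonormal_eigenvectors [CompleteSpace G] {J : G →L[ℂ] H}
    (hJ : IsCompactOperator J) {κ : ℝ} (hκ : 0 < κ) {m : ℕ} {z : Fin m → G} (hz : LinearIndependent ℂ z)
    (hzκ : ∀ x ∈ Submodule.span ℂ (Set.range z), κ * ‖x‖ ^ 2 ≤ ‖J x‖ ^ 2) :
    ∃ f : Fin m → G, Orthonormal ℂ (fun i => J (f i)) ∧
      ∀ i, ∃ c : ℝ, κ ≤ c ∧ ∀ y, inner ℂ (J y) (J (f i)) = c * inner ℂ y (f i) := by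
  suffices h : ∀ k ≤ m, ∃ f : Fin k → G, Orthonormal ℂ (fun i => J (f i)) ∧
      ∀ i, ∃ c : ℝ, κ ≤ c ∧ ∀ y, inner ℂ (J y) (J (f i)) = c * inner ℂ y (f i) from h m le_rfl
  intro k
  induction k with
  | zero => exact fun _ => ⟨fun i => i.elim0, by simp [Orthonormal, Pairwise], fun i => i.elim0⟩
  | succ k ih =>
    intro hk
    obtain ⟨f, hf, hfe⟩ := ih (by omega)
    let S : Submodule ℂ G := Submodule.span ℂ (Set.range f)
    have hmemS : ∀ y, y ∈ Sᗮ ↔ ∀ i, inner ℂ (f i) y = 0 := by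
      intro y
      constructor
      · exact fun hy i => hy _ (Submodule.subset_span ⟨i, rfl⟩)
      · intro hy
        refine (Submodule.mem_orthogonal _ _).2 fun u hu => ?_
        induction hu using Submodule.span_induction with
        | mem x hx => obtain ⟨i, rfl⟩ := hx; exact hy i
        | zero => simp
        | add a b _ _ ha hb => rw [inner_add_left, ha, hb, add_zero]
        | smul c a _ ha => rw [inner_smul_left, ha, mul_zero]
    let T : G →L[ℂ] G := (ContinuousLinearMap.adjoint J).comp J
    have hTinner : ∀ a b, inner ℂ a (T b) = inner ℂ (J a) (J b) := fun a b => by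
      simp [T, ContinuousLinearMap.adjoint_inner_right]
    have hTinner' : ∀ a b, inner ℂ (T a) b = inner ℂ (J a) (J b) := fun a b => by
      simp [T, ContinuousLinearMap.adjoint_inner_left]
    have hTs : (T : G →ₗ[ℂ] G).IsSymmetric := fun a b => by
      change inner ℂ (T a) b = inner ℂ a (T b)
      rw [hTinner, hTinner']
    have hTc : IsCompactOperator T := hJ.clm_comp (ContinuousLinearMap.adjoint J)
    have hinv : ∀ y ∈ Sᗮ, T y ∈ Sᗮ := by
      intro y hy
      rw [hmemS] at hy ⊢
      intro i
      obtain ⟨c, _, hc⟩ := hfe i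
      rw [hTinner, ← inner_conj_symm, hc, ← inner_conj_symm, hy i]
      simp
    -- a vector of the trial space orthogonal to the eigenvectors already found
    obtain ⟨x, hx0, hxW, hxS⟩ : ∃ x : G, x ≠ 0 ∧ x ∈ Submodule.span ℂ (Set.range z) ∧ x ∈ Sᗮ := by
      let Φ : (Fin m → ℂ) →ₗ[ℂ] (Fin k → ℂ) :=
        LinearMap.pi fun i => (innerₛₗ ℂ (f i)).comp (Fintype.linearCombination ℂ z)
      have hker : LinearMap.ker Φ ≠ ⊥ := LinearMap.ker_ne_bot_of_finrank_lt (by simpa using hk)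
      obtain ⟨c, hc, hc0⟩ := Submodule.exists_mem_ne_zero_of_ne_bot hker
      refine ⟨Fintype.linearCombination ℂ z c, ?_, ?_, ?_⟩
      · intro h0
        exact hc0 (linearIndependent_iff_injective_fintypeLinearCombination.1 hz
          (by simpa using h0))
      · rw [← Fintype.range_linearCombination ℂ]
        exact ⟨c, rfl⟩
      · rw [hmemS]
        intro i
        exact congrFun (LinearMap.mem_ker.1 hc) i
    -- the restriction of `J† J` to the complement of the old eigenvectors yields a new one
    let TS : Sᗮ →L[ℂ] Sᗮ := T.restrict hinv
    have hTS : ∀ y : Sᗮ, ((TS y : Sᗮ) : G) = T y := fun y => rfl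
    obtain ⟨c, hc, ⟨y, hyS⟩, hy0, hye⟩ := exists_eigenvector_of_le_rayleigh (T := TS)
      (hTc.restrict' hinv) (hTs.restrict_invariant hinv)
      (fun y => by
        rw [Submodule.coe_inner, hTS, hTinner', inner_self_eq_norm_sq_to_K]
        norm_cast
        exact sq_nonneg _)
      hκ (x := ⟨x, hxS⟩) (by simpa using hx0)
      (by
        rw [Submodule.coe_inner, hTS, hTinner', inner_self_eq_norm_sq_to_K]
        exact_mod_cast hzκ x hxW)
    have hyT : T y = (c : ℂ) • y := congrArg Subtype.val hye
    have hy0' : y ≠ 0 := by simpa using hy0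
    have hc0 : 0 < c := hκ.trans_le hc
    have hJy : ‖J y‖ ≠ 0 := by
      have h : inner ℂ (J y) (J y) = c * inner ℂ y y := by
        rw [← hTinner, hyT, inner_smul_right]
      intro h0
      rw [norm_eq_zero.1 h0] at h
      simp [hc0.ne', hy0'] at h
    have heig : ∀ v, inner ℂ (J v) (J y) = c * inner ℂ v y := fun v => by
      rw [← hTinner, hyT, inner_smul_right]
    rw [hmemS] at hyS
    let y' : G := ((‖J y‖⁻¹ : ℝ) : ℂ) • y
    have hy' : ∀ v, inner ℂ (J v) (J y') = c * inner ℂ v y' := fun v => by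
      simp only [y', map_smul, inner_smul_right, heig]; ring
    refine ⟨Fin.snoc f y', ?_, ?_⟩
    · have horth : ∀ i, inner ℂ (J (f i)) (J y') = 0 := fun i => by
        rw [hy']; simp [y', hyS i]
      rw [orthonormal_iff_ite] at hf ⊢
      intro i j
      refine Fin.lastCases ?_ (fun i => ?_) i <;> refine Fin.lastCases ?_ (fun j => ?_) j
      · have : ‖J y'‖ = 1 := by
          simp only [y', map_smul, norm_smul]
          simp [hJy]
        simp [inner_self_eq_norm_sq_to_K, this]
      · rw [if_neg (Fin.castSucc_lt_last j).ne']
        simp only [Fin.snoc_last, Fin.snoc_castSucc]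
        rw [← inner_conj_symm, horth, map_zero]
      · rw [if_neg (Fin.castSucc_lt_last i).ne]
        simpa using horth i
      · simpa using hf i j
    · intro i
      refine Fin.lastCases ?_ (fun i => ?_) i
      · exact ⟨c, hc, by simpa using hy'⟩
      · simpa using hfe i

/-- A bounded operator is compact if, on a dense set, its values can be approximated from
finite-dimensional subspaces, uniformly on bounded sets. -/
theorem isCompactOperator_of_approx {J : G →L[ℂ] H} {D : Set G} (hD : Dense D)
    (h : ∀ ε > 0, ∃ S : Submodule ℂ H, FiniteDimensional ℂ S ∧
      ∀ x ∈ D, ∃ s ∈ S, ‖J x - s‖ ≤ ε * ‖x‖) : IsCompactOperator J := by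
  refine (isClosed_setOfPred_isCompactOperator (σ₁₂ := RingHom.id ℂ) (M₁ := G)
    (M₂ := H)).closure_subset (a := J) ?_
  rw [Metric.mem_closure_iff]
  intro ε hε
  obtain ⟨S, hS, hSJ⟩ := h (ε / 2) (by positivity)
  refine ⟨S.starProjection.comp J, ?_, ?_⟩
  · have h1 : IsCompactOperator (S.orthogonalProjectionOnto.comp J) :=
      isCompactOperator_of_locallyCompactSpace_dom _
    exact h1.clm_comp S.subtypeL
  · rw [dist_eq_norm]
    refine lt_of_le_of_lt (ContinuousLinearMap.opNorm_le_bound _ (by positivity : 0 ≤ ε / 2) ?_)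
      (by linarith)
    intro x
    refine hD.induction (P := fun x => ‖(J - S.starProjection.comp J) x‖ ≤ ε / 2 * ‖x‖) ?_ ?_ x
    · intro x hx
      obtain ⟨s, hs, hxs⟩ := hSJ x hx
      refine le_trans ?_ hxs
      have := Submodule.starProjection_minimal (U := S) (J x)
      simp only [sub_apply, ContinuousLinearMap.comp_apply]
      rw [this]
      exact ciInf_le ⟨0, by rintro _ ⟨y, rfl⟩; positivity⟩ (⟨s, hs⟩ : S)
    · exact isClosed_le (by fun_prop) (by fun_prop)

end MinMax

/-! ### The closed form and its eigenvectors -/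

section Form

variable {Ω U : Set (ℝ × ℝ)}

theorem IsCore.continuous_dx {u : ℝ × ℝ → ℂ} (hu : IsCore U u) : Continuous (dx u) :=
  (hu.1.continuous_fderiv (by simp)).clm_apply continuous_const

theorem IsCore.continuous_dy {u : ℝ × ℝ → ℂ} (hu : IsCore U u) : Continuous (dy u) :=
  (hu.1.continuous_fderiv (by simp)).clm_apply continuous_const

theorem IsCore.hasCompactSupport_dx {u : ℝ × ℝ → ℂ} (hu : IsCore U u) :
    HasCompactSupport (dx u) :=
  hu.2.1.fderiv_apply ℝ _

theorem IsCore.hasCompactSupport_dy {u : ℝ × ℝ → ℂ} (hu : IsCore U u) :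
    HasCompactSupport (dy u) :=
  hu.2.1.fderiv_apply ℝ _

theorem IsCore.memLp {u : ℝ × ℝ → ℂ} (hu : IsCore U u) : MemLp u 2 (volume.restrict Ω) :=
  (hu.1.continuous.memLp_of_hasCompactSupport hu.2.1).restrict _

theorem IsCore.memLp_dx {u : ℝ × ℝ → ℂ} (hu : IsCore U u) : MemLp (dx u) 2 (volume.restrict Ω) :=
  (hu.continuous_dx.memLp_of_hasCompactSupport hu.hasCompactSupport_dx).restrict _

theorem IsCore.memLp_dy {u : ℝ × ℝ → ℂ} (hu : IsCore U u) : MemLp (dy u) 2 (volume.restrict Ω) :=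
  (hu.continuous_dy.memLp_of_hasCompactSupport hu.hasCompactSupport_dy).restrict _

theorem IsCore.differentiable {u : ℝ × ℝ → ℂ} (hu : IsCore U u) : Differentiable ℝ u :=
  hu.1.differentiable (by simp)

theorem IsCore.mono {V : Set (ℝ × ℝ)} {u : ℝ × ℝ → ℂ} (hu : IsCore U u) (h : U ⊆ V) :
    IsCore V u :=
  ⟨hu.1, hu.2.1, hu.2.2.1.trans h, hu.2.2.2⟩

theorem IsCore.add {u v : ℝ × ℝ → ℂ} (hu : IsCore U u) (hv : IsCore U v) : IsCore U (u + v) :=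
  ⟨hu.1.add hv.1, hu.2.1.add hv.2.1,
    (tsupport_add u v).trans (Set.union_subset hu.2.2.1 hv.2.2.1),
    fun x y => by simp only [Pi.add_apply]; rw [hu.2.2.2 x y, hv.2.2.2 x y]; ring⟩

theorem IsCore.const_smul {u : ℝ × ℝ → ℂ} (c : ℂ) (hu : IsCore U u) : IsCore U (c • u) :=
  ⟨hu.1.const_smul c, hu.2.1.smul_left (f := fun _ => c),
    (tsupport_smul_subset_right (fun _ => c) u).trans hu.2.2.1,
    fun x y => by simp only [Pi.smul_apply]; rw [hu.2.2.2 x y]; simp⟩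

theorem isCore_zero : IsCore U 0 :=
  ⟨contDiff_const, HasCompactSupport.zero, by simp [tsupport], by simp⟩

variable (Ω) in
/-- Triples `(u, g, h)` of square integrable functions, with the Hilbert space norm. -/
abbrev Triple : Type := PiLp 2 fun _ : Fin 3 => Lp ℂ 2 (volume.restrict Ω)

/-- The triple `(u, ∂ₓ u, ∂_y u)` of a core function `u`. -/
noncomputable def IsCore.triple {u : ℝ × ℝ → ℂ} (hu : IsCore U u) : Triple Ω :=
  WithLp.toLp 2 ![hu.memLp.toLp u, hu.memLp_dx.toLp (dx u), hu.memLp_dy.toLp (dy u)]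

variable (Ω U) in
/-- The graph of the gradient on the core. -/
noncomputable def coreGraph : Submodule ℂ (Triple Ω) where
  carrier := {x | ∃ (u : ℝ × ℝ → ℂ) (hu : IsCore U u), x = hu.triple}
  add_mem' := by
    rintro _ _ ⟨u, hu, rfl⟩ ⟨v, hv, rfl⟩
    refine ⟨u + v, hu.add hv, ?_⟩
    have h1 : dx (u + v) = dx u + dx v := by
      ext p; simp [dx, fderiv_add (hu.differentiable p) (hv.differentiable p)]
    have h2 : dy (u + v) = dy u + dy v := by
      ext p; simp [dy, fderiv_add (hu.differentiable p) (hv.differentiable p)]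
    ext1 i
    fin_cases i
    · rfl
    · simp only [IsCore.triple, h1]; rfl
    · simp only [IsCore.triple, h2]; rfl
  zero_mem' := by
    refine ⟨0, isCore_zero, ?_⟩
    have h1 : dx 0 = 0 := by ext p; simp [dx]
    have h2 : dy 0 = 0 := by ext p; simp [dy]
    ext1 i
    fin_cases i
    · rfl
    · simp only [IsCore.triple, h1]; rfl
    · simp only [IsCore.triple, h2]; rfl
  smul_mem' := by
    rintro c _ ⟨u, hu, rfl⟩
    refine ⟨c • u, hu.const_smul c, ?_⟩
    have h1 : dx (c • u) = c • dx u := by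
      ext p; simp [dx, fderiv_const_smul (hu.differentiable p)]
    have h2 : dy (c • u) = c • dy u := by
      ext p; simp [dy, fderiv_const_smul (hu.differentiable p)]
    ext1 i
    fin_cases i
    · rfl
    · simp only [IsCore.triple, h1]; rfl
    · simp only [IsCore.triple, h2]; rfl

variable (Ω U) in
/-- The form domain with its graph norm: the closure of the graph of the gradient on the core. -/
noncomputable def formGraph : Submodule ℂ (Triple Ω) := (coreGraph Ω U).topologicalClosure

instance : CompleteSpace (formGraph Ω U) :=
  (Submodule.isClosed_topologicalClosure _).completeSpace_coe

theorem IsCore.triple_mem {u : ℝ × ℝ → ℂ} (hu : IsCore U u) : hu.triple ∈ formGraph Ω U :=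
  Submodule.le_topologicalClosure _ ⟨u, hu, rfl⟩

theorem tendsto_triple_iff {x : Triple Ω} {w : ℕ → ℝ × ℝ → ℂ} (hw : ∀ k, IsCore U (w k)) :
    Tendsto (fun k => (hw k).triple) atTop (𝓝 x) ↔
      Tendsto (fun k => eLpNorm (fun p => w k p - x 0 p) 2 (volume.restrict Ω)) atTop (𝓝 0) ∧
      Tendsto (fun k => eLpNorm (fun p => dx (w k) p - x 1 p) 2 (volume.restrict Ω)) atTop (𝓝 0) ∧
      Tendsto (fun k => eLpNorm (fun p => dy (w k) p - x 2 p) 2 (volume.restrict Ω)) atTop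
        (𝓝 0) := by
  have key : ∀ (v : ℕ → ℝ × ℝ → ℂ) (hv : ∀ k, MemLp (v k) 2 (volume.restrict Ω))
      (f : Lp ℂ 2 (volume.restrict Ω)), Tendsto (fun k => (hv k).toLp (v k)) atTop (𝓝 f) ↔
        Tendsto (fun k => eLpNorm (fun p => v k p - f p) 2 (volume.restrict Ω)) atTop (𝓝 0) := by
    intro v hv f
    have := Lp.tendsto_Lp_iff_tendsto_eLpNorm'' v hv f (Lp.memLp f) (fi := atTop)
    rw [Lp.toLp_coeFn] at this
    exact this
  rw [← key w (fun k => (hw k).memLp), ← key _ (fun k => (hw k).memLp_dx),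
    ← key _ (fun k => (hw k).memLp_dy)]
  have h0 : Tendsto (fun k => (hw k).triple) atTop (𝓝 x) ↔
      Tendsto (fun k => WithLp.ofLp ((hw k).triple : Triple Ω)) atTop (𝓝 (WithLp.ofLp x)) :=
    ((PiLp.homeomorph 2 fun _ : Fin 3 =>
      Lp ℂ 2 (volume.restrict Ω)).isInducing.tendsto_nhds_iff)
  rw [h0, tendsto_pi_nhds]
  constructor
  · exact fun h => ⟨h 0, h 1, h 2⟩
  · rintro ⟨h1, h2, h3⟩ i
    fin_cases i
    · exact h1
    · exact h2
    · exact h3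

theorem hasFormGradient_iff {x : Triple Ω} :
    HasFormGradient Ω U (x 0) (x 1) (x 2) ↔ x ∈ formGraph Ω U := by
  have hmem : x ∈ formGraph Ω U ↔ x ∈ closure (coreGraph Ω U : Set (Triple Ω)) := Iff.rfl
  rw [hmem, mem_closure_iff_seq_limit]
  constructor
  · rintro ⟨w, hw, h⟩
    exact ⟨fun k => (hw k).triple, fun k => ⟨w k, hw k, rfl⟩, (tendsto_triple_iff hw).2 h⟩
  · rintro ⟨s, hs, h⟩
    choose w hw hsw using hs
    refine ⟨w, hw, (tendsto_triple_iff hw).1 ?_⟩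
    exact h.congr hsw

theorem inner_triple_eq_integral {u : ℝ × ℝ → ℂ} (hu : IsCore U u) (x : Triple Ω) :
    inner ℂ ((hu.triple : Triple Ω) 0) (x 0) = ∫ p in Ω, conj (u p) * x 0 p ∧
    inner ℂ ((hu.triple : Triple Ω) 1) (x 1) + inner ℂ ((hu.triple : Triple Ω) 2) (x 2) =
      ∫ p in Ω, (conj (dx u p) * x 1 p + conj (dy u p) * x 2 p) := by
  have key : ∀ (v : ℝ × ℝ → ℂ) (hv : MemLp v 2 (volume.restrict Ω))
      (f : Lp ℂ 2 (volume.restrict Ω)), inner ℂ (hv.toLp v) f = ∫ p in Ω, conj (v p) * f p ∧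
        Integrable (fun p => conj (v p) * f p) (volume.restrict Ω) := by
    intro v hv f
    have hae : (fun p => inner ℂ (hv.toLp v p) (f p)) =ᵐ[volume.restrict Ω]
        fun p => conj (v p) * f p := by
      filter_upwards [hv.coeFn_toLp] with p hp
      rw [hp, RCLike.inner_apply, mul_comm]
    exact ⟨by rw [L2.inner_def, integral_congr_ae hae],
      (L2.integrable_inner (𝕜 := ℂ) (hv.toLp v) f).congr hae⟩
  refine ⟨(key u hu.memLp (x 0)).1, ?_⟩
  rw [integral_add (key _ hu.memLp_dx (x 1)).2 (key _ hu.memLp_dy (x 2)).2]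
  exact congrArg₂ _ (key _ hu.memLp_dx (x 1)).1 (key _ hu.memLp_dy (x 2)).1

theorem inner_triple (x y : Triple Ω) :
    inner ℂ x y = inner ℂ (x 0) (y 0) + inner ℂ (x 1) (y 1) + inner ℂ (x 2) (y 2) := by
  rw [PiLp.inner_apply, Fin.sum_univ_three]

theorem norm_sq_triple (x : Triple Ω) :
    ‖x‖ ^ 2 = ‖x 0‖ ^ 2 + ‖x 1‖ ^ 2 + ‖x 2‖ ^ 2 := by
  rw [PiLp.norm_sq_eq_of_L2, Fin.sum_univ_three]

/-- The weak eigenvalue equation, tested against the whole form domain. -/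
theorem isEigenvector_iff {e : ℝ} {u : Lp ℂ 2 (volume.restrict Ω)} :
    IsEigenvector Ω U e u ↔ ∃ x ∈ formGraph Ω U, x 0 = u ∧ ∀ y ∈ formGraph Ω U,
      inner ℂ (y 1) (x 1) + inner ℂ (y 2) (x 2) = (e : ℂ) * inner ℂ (y 0) (x 0) := by
  constructor
  · rintro ⟨g, h, hgrad, hweak⟩
    let x : Triple Ω := WithLp.toLp 2 ![u, g, h]
    refine ⟨x, hasFormGradient_iff.1 hgrad, rfl, fun y hy => ?_⟩
    have hcl : IsClosed {y : Triple Ω | inner ℂ (y 1) (x 1) + inner ℂ (y 2) (x 2) =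
        (e : ℂ) * inner ℂ (y 0) (x 0)} := isClosed_eq (by fun_prop) (by fun_prop)
    refine closure_minimal ?_ hcl hy
    rintro _ ⟨v, hv, rfl⟩
    obtain ⟨h0, h1⟩ := inner_triple_eq_integral hv x
    rw [Set.mem_ofPred_eq, h1, h0]
    exact hweak v hv
  · rintro ⟨x, hx, rfl, hweak⟩
    refine ⟨x 1, x 2, hasFormGradient_iff.2 hx, fun v hv => ?_⟩
    obtain ⟨h0, h1⟩ := inner_triple_eq_integral hv x
    rw [← h1, ← h0]
    exact hweak _ hv.triple_mem

theorem norm_toLp_sq {v : ℝ × ℝ → ℂ} (hv : MemLp v 2 (volume.restrict Ω)) :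
    ‖hv.toLp v‖ ^ 2 = ∫ p in Ω, ‖v p‖ ^ 2 := by
  have h := inner_self_eq_norm_sq_to_K (𝕜 := ℂ) (hv.toLp v)
  rw [L2.inner_def] at h
  have hae : (fun p => inner ℂ (hv.toLp v p) (hv.toLp v p)) =ᵐ[volume.restrict Ω]
      fun p => ((‖v p‖ ^ 2 : ℝ) : ℂ) := by
    filter_upwards [hv.coeFn_toLp] with p hp
    rw [hp, inner_self_eq_norm_sq_to_K]
    simp
  rw [integral_congr_ae hae, integral_complex_ofReal] at h
  exact Complex.ofReal_injective (by push_cast; exact h.symm)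

/-- A lower bound for the quadratic form on the core bounds all eigenvalues from below. -/
theorem le_of_isEigenvector {B e : ℝ} {u : Lp ℂ 2 (volume.restrict Ω)}
    (hB : ∀ w, IsCore U w → B * ∫ p in Ω, ‖w p‖ ^ 2 ≤ ∫ p in Ω, (‖dx w p‖ ^ 2 + ‖dy w p‖ ^ 2))
    (hu : IsEigenvector Ω U e u) (hu1 : ‖u‖ = 1) : B ≤ e := by
  obtain ⟨x, hx, rfl, hweak⟩ := isEigenvector_iff.1 hu
  have hform : B * ‖x 0‖ ^ 2 ≤ ‖x 1‖ ^ 2 + ‖x 2‖ ^ 2 := by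
    have hcl : IsClosed {y : Triple Ω | B * ‖y 0‖ ^ 2 ≤ ‖y 1‖ ^ 2 + ‖y 2‖ ^ 2} :=
      isClosed_le (by fun_prop) (by fun_prop)
    refine closure_minimal ?_ hcl hx
    rintro _ ⟨v, hv, rfl⟩
    have h := hB v hv
    rw [integral_add (hv.memLp_dx.integrable_norm_pow (by simp))
      (hv.memLp_dy.integrable_norm_pow (by simp)), ← norm_toLp_sq hv.memLp,
      ← norm_toLp_sq hv.memLp_dx, ← norm_toLp_sq hv.memLp_dy] at h
    exact h
  have h := hweak x hx
  simp only [inner_self_eq_norm_sq_to_K] at h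
  have h' : ‖x 1‖ ^ 2 + ‖x 2‖ ^ 2 = e * ‖x 0‖ ^ 2 :=
    Complex.ofReal_injective (by push_cast; exact h)
  rw [h', hu1] at hform
  simpa using hform

variable (Ω U) in
/-- The embedding of the form domain into `L²`. -/
noncomputable def formEmbedding : formGraph Ω U →L[ℂ] Lp ℂ 2 (volume.restrict Ω) :=
  (PiLp.proj 2 (fun _ : Fin 3 => Lp ℂ 2 (volume.restrict Ω)) 0).comp (formGraph Ω U).subtypeL

theorem formEmbedding_apply (x : formGraph Ω U) : formEmbedding Ω U x = (x : Triple Ω) 0 := rfl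

theorem inner_sum_of_orthogonal {V : Type*} [NormedAddCommGroup V] [InnerProductSpace ℂ V]
    {m : ℕ} {v : Fin m → V} {b : Fin m → ℝ}
    (h : ∀ i j, inner ℂ (v i) (v j) = if i = j then (b i : ℂ) else 0) (c : Fin m → ℂ) :
    ‖∑ i, c i • v i‖ ^ 2 = ∑ i, ‖c i‖ ^ 2 * b i := by
  have : ((‖∑ i, c i • v i‖ ^ 2 : ℝ) : ℂ) = ((∑ i, ‖c i‖ ^ 2 * b i : ℝ) : ℂ) := by
    have h1 := inner_self_eq_norm_sq_to_K (𝕜 := ℂ) (∑ i, c i • v i)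
    rw [sum_inner] at h1
    simp only [inner_sum, inner_smul_left, inner_smul_right, h] at h1
    simp only [mul_ite, mul_zero, Finset.sum_ite_eq, Finset.mem_univ, if_true] at h1
    push_cast
    refine h1.symm.trans (Finset.sum_congr rfl fun i _ => ?_)
    rw [← mul_assoc, RCLike.mul_conj]
    rfl
  exact_mod_cast this

/-- Rayleigh-Ritz: an orthogonal trial family for a form with compact embedding yields as many
orthonormal eigenvectors, with eigenvalues not above those of the trial family. -/
theorem exists_eigenvectors_of_trial (hJ : IsCompactOperator (formEmbedding Ω U)) {m : ℕ}
    {z : Fin m → Triple Ω} (hz : ∀ i, z i ∈ formGraph Ω U) {a E : ℝ} {e : Fin m → ℝ} (ha : 0 < a)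
    (h0 : ∀ i j, inner ℂ (z i 0) (z j 0) = if i = j then (a : ℂ) else 0)
    (h1 : ∀ i j, inner ℂ (z i 1) (z j 1) + inner ℂ (z i 2) (z j 2) =
      if i = j then ((a * e i : ℝ) : ℂ) else 0)
    (hE : 0 ≤ E) (he : ∀ i, e i ≤ E) :
    ∃ f : Fin m → Lp ℂ 2 (volume.restrict Ω), Orthonormal ℂ f ∧
      ∀ i, ∃ e ≤ E, IsEigenvector Ω U e (f i) := by
  let z' : Fin m → formGraph Ω U := fun i => ⟨z i, hz i⟩
  have hsum0 : ∀ c : Fin m → ℂ, ‖formEmbedding Ω U (∑ i, c i • z' i)‖ ^ 2 =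
      ∑ i, ‖c i‖ ^ 2 * a := by
    intro c
    rw [map_sum]
    simp only [map_smul]
    exact inner_sum_of_orthogonal (v := fun i => formEmbedding Ω U (z' i)) h0 c
  have hsum : ∀ c : Fin m → ℂ, ‖∑ i, c i • z' i‖ ^ 2 = ∑ i, ‖c i‖ ^ 2 * (a * (1 + e i)) := by
    intro c
    refine inner_sum_of_orthogonal (b := fun i => a * (1 + e i)) (fun i j => ?_) c
    rw [Submodule.coe_inner, inner_triple, add_assoc, h0, h1]
    split_ifs
    · push_cast; ring
    · simp
  have hli : LinearIndependent ℂ z' := by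
    rw [Fintype.linearIndependent_iff]
    intro c hc i
    have h := hsum0 c
    rw [hc, map_zero, norm_zero, ← Finset.sum_mul] at h
    have h2 : ∑ i, ‖c i‖ ^ 2 = 0 := by
      rcases mul_eq_zero.1 (show (∑ i, ‖c i‖ ^ 2) * a = 0 by rw [← h]; norm_num) with h | h
      · exact h
      · exact absurd h ha.ne'
    have := (Finset.sum_eq_zero_iff_of_nonneg (fun i _ => sq_nonneg _)).1 h2 i (Finset.mem_univ i)
    simpa using this
  obtain ⟨f, hf, hfe⟩ := exists_orthonormal_eigenvectors hJ (κ := (1 + E)⁻¹) (by positivity) hli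
    (fun x hx => by
      rw [← Fintype.range_linearCombination ℂ] at hx
      obtain ⟨c, rfl⟩ := hx
      rw [Fintype.linearCombination_apply, hsum0, hsum, inv_mul_le_iff₀ (by positivity),
        Finset.mul_sum]
      refine Finset.sum_le_sum fun i _ => ?_
      have := he i
      have h2 : 0 ≤ ‖c i‖ ^ 2 * a := by positivity
      nlinarith)
  refine ⟨_, hf, fun i => ?_⟩
  obtain ⟨c, hc, hce⟩ := hfe i
  have hc0 : 0 < c := (inv_pos.2 (by positivity)).trans_le hc
  refine ⟨c⁻¹ - 1, ?_, isEigenvector_iff.2 ⟨f i, (f i).2, rfl, fun y hy => ?_⟩⟩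
  · have := inv_anti₀ (by positivity) hc
    rw [inv_inv] at this
    linarith
  · have h := hce ⟨y, hy⟩
    rw [Submodule.coe_inner, inner_triple, formEmbedding_apply, formEmbedding_apply] at h
    have hcc : (c : ℂ) ≠ 0 := by exact_mod_cast hc0.ne'
    push_cast
    field_simp
    simp only at h
    linear_combination -h

end Form

/-! ### Poincaré inequality on small squares and compactness of the form embedding -/

section Poincare

/-- The Cauchy-Schwarz inequality against the constant function. -/
theorem sq_integral_le {α : Type*} [MeasurableSpace α] {ν : Measure α} [IsFiniteMeasure ν]
    {g : α → ℝ} (hg : Integrable g ν) (hg2 : Integrable (fun x => g x ^ 2) ν) :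
    (∫ x, g x ∂ν) ^ 2 ≤ ν.real Set.univ * ∫ x, g x ^ 2 ∂ν := by
  set M := ν.real Set.univ with hM
  set m := ∫ x, g x ∂ν with hm
  have key : ∀ t : ℝ, 0 ≤ ∫ x, g x ^ 2 ∂ν - 2 * t * m + t ^ 2 * M := by
    intro t
    have h : ∫ x, (g x - t) ^ 2 ∂ν = ∫ x, g x ^ 2 ∂ν - 2 * t * m + t ^ 2 * M := by
      have h1 : (fun x => (g x - t) ^ 2) = fun x => (g x ^ 2 - 2 * t * g x) + t ^ 2 := by
        ext x; ring
      have h2 : Integrable (fun x => g x ^ 2 - 2 * t * g x) ν := hg2.sub (hg.const_mul _)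
      rw [h1, integral_add h2 (integrable_const _), integral_sub hg2 (hg.const_mul _),
        integral_const_mul, integral_const, smul_eq_mul]
      ring
    rw [← h]
    exact integral_nonneg fun x => sq_nonneg _
  rcases (measureReal_nonneg : 0 ≤ ν.real Set.univ).eq_or_lt with h0 | h0
  · have : ν = 0 := by
      rw [← Measure.measure_univ_eq_zero]
      exact (measureReal_eq_zero_iff).1 h0.symm
    simp [hm, this]
  · have h := key (m / M)
    have hM0 : 0 < M := h0
    have h2 : ∫ x, g x ^ 2 ∂ν - 2 * (m / M) * m + (m / M) ^ 2 * M =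
      (M * ∫ x, g x ^ 2 ∂ν - m ^ 2) / M := by field_simp; ring
    rw [h2] at h
    have := mul_nonneg h hM0.le
    rw [div_mul_cancel₀ _ hM0.ne'] at this
    linarith

/-- The oscillation of a `C¹` function on an interval is controlled by its Dirichlet integral. -/
theorem norm_sub_sq_le_integral {f f' : ℝ → ℂ} (hf : ∀ x, HasDerivAt f (f' x) x)
    (hf' : Continuous f') {a b x c : ℝ} (hx : x ∈ Set.Icc a b) (hc : c ∈ Set.Icc a b) :
    ‖f x - f c‖ ^ 2 ≤ (b - a) * ∫ t in Set.Ioc a b, ‖f' t‖ ^ 2 := by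
  have hab : a ≤ b := hx.1.trans hx.2
  have h1 : ‖f x - f c‖ ≤ ∫ t in Set.Ioc a b, ‖f' t‖ := by
    rw [← intervalIntegral.integral_eq_sub_of_hasDerivAt (fun t _ => hf t)
      (hf'.intervalIntegrable _ _)]
    refine (intervalIntegral.norm_integral_le_abs_integral_norm).trans ?_
    rw [← intervalIntegral.integral_of_le hab,
      ← abs_of_nonneg (intervalIntegral.integral_nonneg hab fun t _ => norm_nonneg (f' t))]
    refine intervalIntegral.abs_integral_mono_interval ?_
      (Eventually.of_forall fun t => norm_nonneg _) (hf'.norm.intervalIntegrable _ _)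
    rw [Set.uIoc_of_le hab]
    exact Set.Ioc_subset_Ioc (le_min hc.1 hx.1) (max_le hc.2 hx.2)
  have h2 := sq_integral_le (ν := volume.restrict (Set.Ioc a b)) (g := fun t => ‖f' t‖)
    (hf'.norm.integrableOn_Ioc) ((hf'.norm.pow 2).integrableOn_Ioc)
  have h3 : (volume.restrict (Set.Ioc a b)).real Set.univ = b - a := by
    rw [measureReal_restrict_apply_univ, Real.volume_real_Ioc_of_le hab]
  rw [h3] at h2
  exact (pow_le_pow_left₀ (norm_nonneg _) h1 2).trans h2

theorem hasDerivAt_slice_fst {w : ℝ × ℝ → ℂ} (hw : Differentiable ℝ w) (y x : ℝ) :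
    HasDerivAt (fun x => w (x, y)) (dx w (x, y)) x :=
  (hw (x, y)).hasFDerivAt.comp_hasDerivAt x ((hasDerivAt_id x).prodMk (hasDerivAt_const x y))

theorem hasDerivAt_slice_snd {w : ℝ × ℝ → ℂ} (hw : Differentiable ℝ w) (x y : ℝ) :
    HasDerivAt (fun y => w (x, y)) (dy w (x, y)) y :=
  (hw (x, y)).hasFDerivAt.comp_hasDerivAt y ((hasDerivAt_const y x).prodMk (hasDerivAt_id y))

theorem _root_.Continuous.integrableOn_Ioc_prod {E : Type*} [NormedAddCommGroup E]
    {F : ℝ × ℝ → E} (hF : Continuous F) (a a' b b' : ℝ) :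
    IntegrableOn F (Set.Ioc a a' ×ˢ Set.Ioc b b') :=
  (hF.continuousOn.integrableOn_compact (isCompact_Icc.prod isCompact_Icc)).mono_set
    (Set.prod_mono Set.Ioc_subset_Icc_self Set.Ioc_subset_Icc_self)

/-- Poincaré's inequality on a square of side `h`, for functions of class `C¹`. -/
theorem poincare_square {w : ℝ × ℝ → ℂ} (hw : Differentiable ℝ w) (hdx : Continuous (dx w))
    (hdy : Continuous (dy w)) (a b : ℝ) {h : ℝ} (hh : 0 < h) :
    ∃ c : ℂ, ∫ p in Set.Ioc a (a + h) ×ˢ Set.Ioc b (b + h), ‖w p - c‖ ^ 2 ≤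
      2 * h ^ 2 * ∫ p in Set.Ioc a (a + h) ×ˢ Set.Ioc b (b + h),
        (‖dx w p‖ ^ 2 + ‖dy w p‖ ^ 2) := by
  set I := Set.Ioc a (a + h) with hI
  set J := Set.Ioc b (b + h) with hJ
  have hwc : Continuous w := hw.continuous
  have hIr : volume.real I = h := by rw [hI, Real.volume_real_Ioc_of_le (by linarith)]; ring
  have hJr : volume.real J = h := by rw [hJ, Real.volume_real_Ioc_of_le (by linarith)]; ring
  have hq : volume.real (I ×ˢ J) = h ^ 2 := by
    rw [Measure.volume_eq_prod, measureReal_prod_prod, hIr, hJr, sq]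
  have hqfin : volume (I ×ˢ J) ≠ ⊤ := by
    rw [Measure.volume_eq_prod, Measure.prod_prod]
    simp [hI, hJ, ENNReal.mul_eq_top]
  have : IsFiniteMeasure (volume.restrict (I ×ˢ J)) := isFiniteMeasure_restrict.2 hqfin
  set A : ℝ → ℝ := fun y => ∫ ξ in I, ‖dx w (ξ, y)‖ ^ 2 with hA
  set B : ℝ → ℝ := fun x => ∫ η in J, ‖dy w (x, η)‖ ^ 2 with hB
  have hAc : Continuous A := by
    have h1 : Continuous (Function.uncurry fun y ξ : ℝ => ‖dx w (ξ, y)‖ ^ 2) :=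
      ((hdx.comp continuous_swap).norm.pow 2)
    have := intervalIntegral.continuous_parametric_intervalIntegral_of_continuous'
      (μ := volume) h1 a (a + h)
    simpa only [intervalIntegral.integral_of_le (show a ≤ a + h by linarith)] using this
  have hBc : Continuous B := by
    have h1 : Continuous (Function.uncurry fun x η : ℝ => ‖dy w (x, η)‖ ^ 2) :=
      (hdy.norm.pow 2)
    have := intervalIntegral.continuous_parametric_intervalIntegral_of_continuous'
      (μ := volume) h1 b (b + h)
    simpa only [intervalIntegral.integral_of_le (show b ≤ b + h by linarith)] using this
  -- move from `p` to `p'` first horizontally, then vertically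
  have hosc : ∀ p ∈ I ×ˢ J, ∀ p' ∈ I ×ˢ J,
      ‖w p - w p'‖ ^ 2 ≤ 2 * h * A p.2 + 2 * h * B p'.1 := by
    rintro ⟨x, y⟩ ⟨hx, hy⟩ ⟨x', y'⟩ ⟨hx', hy'⟩
    have h1 := norm_sub_sq_le_integral (hasDerivAt_slice_fst hw y) (by fun_prop)
      (Set.Ioc_subset_Icc_self hx) (Set.Ioc_subset_Icc_self hx')
    have h2 := norm_sub_sq_le_integral (hasDerivAt_slice_snd hw x') (by fun_prop)
      (Set.Ioc_subset_Icc_self hy) (Set.Ioc_subset_Icc_self hy')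
    rw [add_sub_cancel_left] at h1 h2
    have h3 : ‖w (x, y) - w (x', y')‖ ≤ ‖w (x, y) - w (x', y)‖ + ‖w (x', y) - w (x', y')‖ :=
      norm_sub_le_norm_sub_add_norm_sub _ _ _
    have h4 := pow_le_pow_left₀ (norm_nonneg _) h3 2
    have h5 := add_sq_le (a := ‖w (x, y) - w (x', y)‖) (b := ‖w (x', y) - w (x', y')‖)
    calc _ ≤ _ := h4
      _ ≤ _ := h5
      _ ≤ 2 * (h * A y + h * B x') := by gcongr
      _ = _ := by ring
  have hBint : ∫ p' in I ×ˢ J, B p'.1 = h * ∫ x in I, B x := by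
    have := setIntegral_prod_mul (μ := volume) (ν := volume) B (fun _ : ℝ => (1 : ℝ)) I J
    simp only [mul_one] at this
    rw [Measure.volume_eq_prod, this]
    simp [hJr, mul_comm]
  have hAint : ∫ p in I ×ˢ J, A p.2 = h * ∫ y in J, A y := by
    have := setIntegral_prod_mul (μ := volume) (ν := volume) (fun _ : ℝ => (1 : ℝ)) A I J
    simp only [one_mul] at this
    rw [Measure.volume_eq_prod, this]
    simp [hIr]
  have hdx2 : Continuous fun p => ‖dx w p‖ ^ 2 := by fun_prop
  have hdy2 : Continuous fun p => ‖dy w p‖ ^ 2 := by fun_prop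
  have hBtot : ∫ x in I, B x = ∫ p in I ×ˢ J, ‖dy w p‖ ^ 2 := by
    rw [Measure.volume_eq_prod, setIntegral_prod _ (hdy2.integrableOn_Ioc_prod _ _ _ _)]
  have hAtot : ∫ y in J, A y = ∫ p in I ×ˢ J, ‖dx w p‖ ^ 2 := by
    rw [Measure.volume_eq_prod, ← setIntegral_prod_swap, setIntegral_prod]
    · rfl
    · exact (((hdx.comp continuous_swap).norm.pow 2).integrableOn_Ioc_prod _ _ _ _)
  set c : ℂ := ((h ^ 2)⁻¹ : ℝ) • ∫ p in I ×ˢ J, w p with hc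
  refine ⟨c, ?_⟩
  have hpt : ∀ p ∈ I ×ˢ J, ‖w p - c‖ ^ 2 ≤ 2 * h * A p.2 + 2 * ∫ x in I, B x := by
    intro p hp
    have e1 : w p - c = ((h ^ 2)⁻¹ : ℝ) • ∫ p' in I ×ˢ J, (w p - w p') := by
      rw [integral_sub (integrable_const _) (hwc.integrableOn_Ioc_prod _ _ _ _),
        integral_const, measureReal_restrict_apply_univ, hq, smul_sub, smul_smul,
        inv_mul_cancel₀ (by positivity), one_smul]
    have e2 : ‖∫ p' in I ×ˢ J, (w p - w p')‖ ^ 2 ≤ h ^ 2 * ∫ p' in I ×ˢ J, ‖w p - w p'‖ ^ 2 := by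
      have hcont : Continuous fun p' => ‖w p - w p'‖ := (continuous_const.sub hwc).norm
      have := sq_integral_le (ν := volume.restrict (I ×ˢ J)) (g := fun p' => ‖w p - w p'‖)
        (hcont.integrableOn_Ioc_prod _ _ _ _) ((hcont.pow 2).integrableOn_Ioc_prod _ _ _ _)
      rw [measureReal_restrict_apply_univ, hq] at this
      exact (pow_le_pow_left₀ (norm_nonneg _) (norm_integral_le_integral_norm _) 2).trans this
    have e3 : ∫ p' in I ×ˢ J, ‖w p - w p'‖ ^ 2 ≤
        ∫ p' in I ×ˢ J, (2 * h * A p.2 + 2 * h * B p'.1) := by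
      refine setIntegral_mono_on ?_ ?_ (measurableSet_Ioc.prod measurableSet_Ioc) (hosc p hp)
      · exact ((continuous_const.sub hwc).norm.pow 2).integrableOn_Ioc_prod _ _ _ _
      · exact Continuous.integrableOn_Ioc_prod (by fun_prop) _ _ _ _
    have e4 : ∫ p' in I ×ˢ J, (2 * h * A p.2 + 2 * h * B p'.1) =
        h ^ 2 * (2 * h * A p.2 + 2 * ∫ x in I, B x) := by
      rw [integral_add (integrable_const _)
        (Continuous.integrableOn_Ioc_prod (by fun_prop) _ _ _ _), integral_const,
        measureReal_restrict_apply_univ, hq, integral_const_mul, hBint, smul_eq_mul]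
      ring
    rw [e1, norm_smul, mul_pow]
    calc _ ≤ ‖((h ^ 2)⁻¹ : ℝ)‖ ^ 2 * (h ^ 2 * (h ^ 2 * (2 * h * A p.2 + 2 * ∫ x in I, B x))) := by
          gcongr; exact e2.trans (by gcongr; exact e3.trans e4.le)
      _ = _ := by
          rw [Real.norm_of_nonneg (by positivity)]
          field_simp
  calc _ ≤ ∫ p in I ×ˢ J, (2 * h * A p.2 + 2 * ∫ x in I, B x) := by
        refine setIntegral_mono_on ?_ ?_ (measurableSet_Ioc.prod measurableSet_Ioc) hpt
        · exact ((hwc.sub continuous_const).norm.pow 2).integrableOn_Ioc_prod _ _ _ _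
        · exact Continuous.integrableOn_Ioc_prod (by fun_prop) _ _ _ _
    _ = 2 * h ^ 2 * ∫ p in I ×ˢ J, (‖dx w p‖ ^ 2 + ‖dy w p‖ ^ 2) := by
        rw [integral_add (Continuous.integrableOn_Ioc_prod (by fun_prop) _ _ _ _)
          (integrable_const _), integral_const, measureReal_restrict_apply_univ, hq,
          integral_const_mul, hAint, smul_eq_mul,
          integral_add (hdx2.integrableOn_Ioc_prod _ _ _ _) (hdy2.integrableOn_Ioc_prod _ _ _ _),
          ← hAtot, ← hBtot]
        ring

end Poincare

section Rellich

theorem measurableSet_config (d : ℝ) : MeasurableSet (config d) := by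
  refine IsClosed.measurableSet ?_
  have : config d = {p | 0 ≤ p.1} ∩ ({p | 0 ≤ p.2} ∩ {p | |p.1 - p.2| ≤ d}) := rfl
  rw [this]
  exact (isClosed_le (by fun_prop) (by fun_prop)).inter
    ((isClosed_le (by fun_prop) (by fun_prop)).inter (isClosed_le (by fun_prop) (by fun_prop)))

theorem configBox_subset (d L : ℝ) : configBox d L ⊆ Set.Icc 0 L ×ˢ Set.Icc 0 L :=
  fun _ hp => ⟨⟨hp.1.1, hp.2.1⟩, ⟨hp.1.2.1, hp.2.2⟩⟩

theorem Ioc_prod_ae_eq_Icc_prod (L : ℝ) :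
    (Set.Ioc 0 L ×ˢ Set.Ioc 0 L : Set (ℝ × ℝ)) =ᵐ[volume] Set.Icc 0 L ×ˢ Set.Icc 0 L :=
  Measure.set_prod_ae_eq Ioc_ae_eq_Icc Ioc_ae_eq_Icc

theorem IsCore.dx_eq_zero {U : Set (ℝ × ℝ)} {u : ℝ × ℝ → ℂ} (hu : IsCore U u) {p : ℝ × ℝ}
    (hp : p ∉ U) : dx u p = 0 := by
  have : fderiv ℝ u p = 0 := by
    by_contra h
    exact hp (hu.2.2.1 (tsupport_fderiv_subset ℝ (subset_tsupport _ h)))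
  simp [dx, this]

theorem IsCore.dy_eq_zero {U : Set (ℝ × ℝ)} {u : ℝ × ℝ → ℂ} (hu : IsCore U u) {p : ℝ × ℝ}
    (hp : p ∉ U) : dy u p = 0 := by
  have : fderiv ℝ u p = 0 := by
    by_contra h
    exact hp (hu.2.2.1 (tsupport_fderiv_subset ℝ (subset_tsupport _ h)))
  simp [dy, this]

theorem IsCore.eq_zero {U : Set (ℝ × ℝ)} {u : ℝ × ℝ → ℂ} (hu : IsCore U u) {p : ℝ × ℝ}
    (hp : p ∉ U) : u p = 0 :=
  image_eq_zero_of_notMem_tsupport fun h => hp (hu.2.2.1 h)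

/-- The integral over a square is the sum of the integrals over the `N²` squares of a grid. -/
theorem setIntegral_square_eq_sum {F : ℝ × ℝ → ℝ} {h : ℝ} (hh : 0 < h) (N : ℕ)
    (hF : IntegrableOn F (Set.Ioc 0 (N * h) ×ˢ Set.Ioc 0 (N * h))) :
    ∫ p in Set.Ioc 0 (N * h) ×ˢ Set.Ioc 0 (N * h), F p =
      ∑ i ∈ Finset.range N ×ˢ Finset.range N, ∫ p in
        Set.Ioc (i.1 * h) (i.1 * h + h) ×ˢ Set.Ioc (i.2 * h) (i.2 * h + h), F p := by
  have hmono : Monotone fun n : ℕ => (n : ℝ) * h := fun m n hmn => by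
    dsimp only; gcongr
  have hstep : ∀ n : ℕ, Set.Ioc ((n : ℝ) * h) (n * h + h) =
      Set.Ioc ((n : ℝ) * h) ((Order.succ n : ℕ) * h) := fun n => by
    simp [add_mul]
  have hun : Set.Ioc (0 : ℝ) (N * h) ×ˢ Set.Ioc (0 : ℝ) (N * h) =
      ⋃ i ∈ Finset.range N ×ˢ Finset.range N,
        Set.Ioc ((i.1 : ℝ) * h) (i.1 * h + h) ×ˢ Set.Ioc ((i.2 : ℝ) * h) (i.2 * h + h) := by
    have h1 := hmono.biUnion_Ico_Ioc_map_succ 0 N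
    simp only [Nat.cast_zero, zero_mul] at h1
    ext ⟨x, y⟩
    rw [Set.mem_prod, ← h1]
    simp only [Set.mem_iUnion, Finset.mem_product, Finset.mem_range, hstep, Set.mem_prod,
      Set.mem_Ico, zero_le, true_and, exists_prop, Prod.exists]
    constructor
    · rintro ⟨⟨i, hi, hx⟩, ⟨j, hj, hy⟩⟩
      exact ⟨i, j, ⟨hi, hj⟩, hx, hy⟩
    · rintro ⟨i, j, ⟨hi, hj⟩, hx, hy⟩
      exact ⟨⟨i, hi, hx⟩, ⟨j, hj, hy⟩⟩
  rw [hun] at hF ⊢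
  refine integral_biUnion_finset _ (fun i _ => measurableSet_Ioc.prod measurableSet_Ioc) ?_ ?_
  · rintro ⟨i, j⟩ - ⟨i', j'⟩ - hne
    simp only [Function.onFun, hstep]
    rw [Set.disjoint_prod]
    by_cases hi : i = i'
    · right
      exact hmono.pairwise_disjoint_on_Ioc_succ fun hj => hne (by rw [hi, hj])
    · left
      exact hmono.pairwise_disjoint_on_Ioc_succ hi
  · exact fun i hi => hF.mono_set (Set.subset_biUnion_of_mem (u := fun i : ℕ × ℕ =>
      Set.Ioc ((i.1 : ℝ) * h) (i.1 * h + h) ×ˢ Set.Ioc ((i.2 : ℝ) * h) (i.2 * h + h)) hi)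

/-- Rellich's theorem for the pair: the form domain on `Ω_L` embeds compactly. A core function
vanishes on the part of the square `(0, L]²` outside `Ω_L`, so by Poincaré's inequality it is
close to a function that is constant on each square of a fine grid. -/
theorem isCompactOperator_formEmbedding (edge : EdgeCondition) (d : ℝ) {L : ℝ} (hL : 0 < L) :
    IsCompactOperator (formEmbedding (configBox d L) (supportBox edge d L)) := by
  set Ω := configBox d L with hΩ
  set U := supportBox edge d L with hU
  have hdense : Dense {x : formGraph Ω U | (x : Triple Ω) ∈ coreGraph Ω U} := by
    intro x
    have hx : (x : Triple Ω) ∈ closure (coreGraph Ω U : Set (Triple Ω)) := x.2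
    rw [mem_closure_iff_seq_limit] at hx ⊢
    obtain ⟨s, hs, hsx⟩ := hx
    refine ⟨fun k => ⟨s k, Submodule.le_topologicalClosure _ (hs k)⟩, hs, ?_⟩
    rw [tendsto_subtype_rng]
    exact hsx
  refine isCompactOperator_of_approx hdense fun ε hε => ?_
  obtain ⟨N, hN⟩ := exists_nat_gt (2 * L / ε)
  have hN0 : 0 < (N : ℝ) := lt_of_le_of_lt (by positivity) hN
  set h := L / N with hh
  have hh0 : 0 < h := by positivity
  have hNh : N * h = L := by rw [hh]; field_simp
  have hhε : h ≤ ε / 2 := by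
    rw [hh, div_le_div_iff₀ hN0 (by norm_num)]
    rw [div_lt_iff₀ hε] at hN
    linarith
  let q : ℕ × ℕ → Set (ℝ × ℝ) := fun i =>
    Set.Ioc ((i.1 : ℝ) * h) (i.1 * h + h) ×ˢ Set.Ioc ((i.2 : ℝ) * h) (i.2 * h + h)
  have hqm : ∀ i, MeasurableSet (q i) := fun i => measurableSet_Ioc.prod measurableSet_Ioc
  have hqfin : ∀ i, volume.restrict Ω (q i) ≠ ⊤ := fun i => by
    refine ne_top_of_le_ne_top ?_ (Measure.restrict_apply_le _ _)
    simp [q, Measure.volume_eq_prod, Measure.prod_prod, ENNReal.mul_eq_top]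
  let b : ℕ × ℕ → Lp ℂ 2 (volume.restrict Ω) := fun i =>
    indicatorConstLp 2 (hqm i) (hqfin i) (1 : ℂ)
  let idx : Finset (ℕ × ℕ) := Finset.range N ×ˢ Finset.range N
  refine ⟨Submodule.span ℂ (b '' idx), FiniteDimensional.span_of_finite ℂ
    (idx.finite_toSet.image b), ?_⟩
  rintro ⟨x, hxG⟩ ⟨w, hw, hxw⟩
  simp only at hxw
  subst hxw
  choose c hc using fun i : ℕ × ℕ => poincare_square hw.differentiable hw.continuous_dx
    hw.continuous_dy (i.1 * h) (i.2 * h) hh0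
  refine ⟨∑ i ∈ idx, c i • b i, Submodule.sum_mem _ fun i hi =>
    Submodule.smul_mem _ _ (Submodule.subset_span ⟨i, hi, rfl⟩), ?_⟩
  set Q : Set (ℝ × ℝ) := Set.Ioc 0 L ×ˢ Set.Ioc 0 L with hQ
  let g : ℝ × ℝ → ℂ := fun p => ∑ i ∈ idx, c i • (q i).indicator (fun _ => (1 : ℂ)) p
  have hgm : MemLp g 2 (volume.restrict Q) := by
    refine memLp_finsetSum _ fun i _ => MemLp.const_smul ?_ (c i)
    refine memLp_indicator_const 2 (hqm i) 1 (Or.inr ?_)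
    refine ne_top_of_le_ne_top ?_ (Measure.restrict_apply_le _ _)
    simp [q, Measure.volume_eq_prod, Measure.prod_prod, ENNReal.mul_eq_top]
  have hgq : ∀ i ∈ idx, ∀ p ∈ q i, g p = c i := by
    intro i hi p hp
    have hmono : Monotone fun n : ℕ => (n : ℝ) * h := fun m n hmn => by
      dsimp only; gcongr
    have huniq : ∀ (m n : ℕ) (t : ℝ), t ∈ Set.Ioc ((m : ℝ) * h) (m * h + h) →
        t ∈ Set.Ioc ((n : ℝ) * h) (n * h + h) → m = n := by
      intro m n t hm hn
      by_contra hne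
      have := hmono.pairwise_disjoint_on_Ioc_succ hne
      refine Disjoint.notMem_of_mem_left this (a := t) ?_ ?_
      · simpa [add_mul] using hm
      · simpa [add_mul] using hn
    simp only [g]
    rw [Finset.sum_eq_single i]
    · simp [hp]
    · intro j _ hji
      rw [Set.indicator_of_notMem, smul_zero]
      intro hpj
      exact hji (Prod.ext (huniq _ _ _ hpj.1 hp.1) (huniq _ _ _ hpj.2 hp.2))
    · exact fun hni => absurd hi hni
  have hΩQ : Ω ≤ᵐ[volume] Q :=
    (configBox_subset d L).eventuallyLE.trans (Ioc_prod_ae_eq_Icc_prod L).symm.le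
  have hwQ : MemLp w 2 (volume.restrict Q) := hw.memLp
  have hrestr : volume.restrict Ω ≤ volume.restrict Q := Measure.restrict_mono_ae hΩQ
  have hsum : ∑ i ∈ idx, c i • b i = (hgm.mono_measure hrestr).toLp g := by
    refine Lp.ext ?_
    refine (Lp.coeFn_finsetSum _ _).trans ?_
    have h1 : ∀ i ∈ idx, ((c i • b i : Lp ℂ 2 (volume.restrict Ω)) : ℝ × ℝ → ℂ)
        =ᵐ[volume.restrict Ω] fun p => c i • (q i).indicator (fun _ => (1 : ℂ)) p := by
      intro i _
      filter_upwards [Lp.coeFn_smul (c i) (b i), indicatorConstLp_coeFn (p := 2) (hs := hqm i)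
        (hμs := hqfin i) (c := (1 : ℂ))] with p h1 h2
      rw [h1, Pi.smul_apply, h2]
    have h2 := (Filter.eventually_all_finset idx).2 h1
    filter_upwards [h2, (hgm.mono_measure hrestr).coeFn_toLp] with p h3 h4
    rw [h4, Finset.sum_apply]
    exact Finset.sum_congr rfl h3
  have hJ : formEmbedding Ω U ⟨hw.triple, hxG⟩ = hw.memLp.toLp w := rfl
  have hnorm : ‖hw.memLp.toLp w - ∑ i ∈ idx, c i • b i‖ ^ 2 ≤
      2 * h ^ 2 * ∫ p in Ω, (‖dx w p‖ ^ 2 + ‖dy w p‖ ^ 2) := by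
    rw [hsum, ← MemLp.toLp_sub, norm_toLp_sq]
    have hint : IntegrableOn (fun p => ‖(w - g) p‖ ^ 2) Q := (hwQ.sub hgm).integrable_norm_pow
      (by simp)
    have hgrad : Continuous fun p => ‖dx w p‖ ^ 2 + ‖dy w p‖ ^ 2 := by
      have := hw.continuous_dx
      have := hw.continuous_dy
      fun_prop
    calc ∫ p in Ω, ‖(w - g) p‖ ^ 2 ≤ ∫ p in Q, ‖(w - g) p‖ ^ 2 :=
          setIntegral_mono_set hint (Eventually.of_forall fun p => sq_nonneg _) hΩQ
      _ = ∑ i ∈ idx, ∫ p in q i, ‖(w - g) p‖ ^ 2 := by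
          rw [hQ, ← hNh] at hint ⊢
          exact setIntegral_square_eq_sum hh0 N hint
      _ = ∑ i ∈ idx, ∫ p in q i, ‖w p - c i‖ ^ 2 := by
          refine Finset.sum_congr rfl fun i hi => setIntegral_congr_fun (hqm i) fun p hp => ?_
          simp only [Pi.sub_apply, hgq i hi p hp]
      _ ≤ ∑ i ∈ idx, 2 * h ^ 2 * ∫ p in q i, (‖dx w p‖ ^ 2 + ‖dy w p‖ ^ 2) :=
          Finset.sum_le_sum fun i _ => hc i
      _ = 2 * h ^ 2 * ∫ p in Q, (‖dx w p‖ ^ 2 + ‖dy w p‖ ^ 2) := by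
          rw [← Finset.mul_sum, hQ, ← hNh]
          rw [setIntegral_square_eq_sum hh0 N (hgrad.integrableOn_Ioc_prod _ _ _ _)]
      _ = 2 * h ^ 2 * ∫ p in Ω, (‖dx w p‖ ^ 2 + ‖dy w p‖ ^ 2) := by
          congr 1
          rw [setIntegral_congr_set (Ioc_prod_ae_eq_Icc_prod L)]
          refine setIntegral_eq_of_subset_of_forall_sdiff_eq_zero
            (measurableSet_Icc.prod measurableSet_Icc) (configBox_subset d L) ?_
          rintro p ⟨⟨hp1, hp2⟩, hpΩ⟩
          have hpU : p ∉ U := fun hpU =>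
            hpΩ ⟨⟨hp1.1, hp2.1, le_of_lt hpU.1.1⟩, hp1.2, hp2.2⟩
          simp [hw.dx_eq_zero hpU, hw.dy_eq_zero hpU]
  have hfinal : ‖hw.memLp.toLp w - ∑ i ∈ idx, c i • b i‖ ^ 2 ≤
      (ε * ‖(hw.triple : Triple Ω)‖) ^ 2 := by
    refine hnorm.trans ?_
    have h1 : ∫ p in Ω, (‖dx w p‖ ^ 2 + ‖dy w p‖ ^ 2) ≤ ‖(hw.triple : Triple Ω)‖ ^ 2 := by
      rw [integral_add (hw.memLp_dx.integrable_norm_pow (by simp))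
        (hw.memLp_dy.integrable_norm_pow (by simp)), ← norm_toLp_sq hw.memLp_dx,
        ← norm_toLp_sq hw.memLp_dy, norm_sq_triple, add_assoc]
      exact le_add_of_nonneg_left (sq_nonneg _)
    calc _ ≤ 2 * (ε / 2) ^ 2 * ‖(hw.triple : Triple Ω)‖ ^ 2 := by gcongr
      _ ≤ (ε * ‖(hw.triple : Triple Ω)‖) ^ 2 := by
        rw [mul_pow]
        have : 0 ≤ ε ^ 2 * ‖(hw.triple : Triple Ω)‖ ^ 2 := by positivity
        nlinarith
  rw [hJ]
  exact le_of_sq_le_sq hfinal (by positivity)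

end Rellich

/-! ### Lower bounds for the quadratic form -/

section LowerBound

/-- Wirtinger's inequality with Dirichlet conditions, with the sharp constant. For `k` below
`π / (b - a)` the function `q = k tan (k (t - (a + b) / 2))` is smooth on `[a, b]` and satisfies
`q' = k² + q²`, so that `‖f' + q f‖² = ‖f'‖² - k² ‖f‖² + (q ‖f‖²)'`. -/
theorem wirtinger_dirichlet {f f' : ℝ → ℂ} (hf : ∀ x, HasDerivAt f (f' x) x) (hf' : Continuous f')
    {a b : ℝ} (hab : a < b) (ha : f a = 0) (hb : f b = 0) :
    (Real.pi / (b - a)) ^ 2 * ∫ t in a..b, ‖f t‖ ^ 2 ≤ ∫ t in a..b, ‖f' t‖ ^ 2 := by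
  have hfc : Continuous f := continuous_iff_continuousAt.2 fun x => (hf x).continuousAt
  have hba : 0 < b - a := sub_pos.2 hab
  have key : ∀ k ∈ Set.Ioo 0 (Real.pi / (b - a)),
      k ^ 2 * ∫ t in a..b, ‖f t‖ ^ 2 ≤ ∫ t in a..b, ‖f' t‖ ^ 2 := by
    rintro k ⟨hk0, hk⟩
    rw [lt_div_iff₀ hba] at hk
    set q : ℝ → ℝ := fun t => k * Real.tan (k * (t - (a + b) / 2)) with hq
    have hcos : ∀ t ∈ Set.Icc a b, Real.cos (k * (t - (a + b) / 2)) ≠ 0 := by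
      rintro t ⟨h1, h2⟩
      refine (Real.cos_pos_of_mem_Ioo ⟨?_, ?_⟩).ne' <;> nlinarith
    have hqd : ∀ t ∈ Set.Icc a b, HasDerivAt q (k ^ 2 + q t ^ 2) t := by
      intro t ht
      have h1 := (Real.hasDerivAt_tan (hcos t ht)).comp t
        (((hasDerivAt_id t).sub_const ((a + b) / 2)).const_mul k)
      refine (h1.const_mul k).congr_deriv ?_
      have h2 := hcos t ht
      have h3 := Real.sin_sq_add_cos_sq (k * (t - (a + b) / 2))
      simp only [hq, Real.tan_eq_sin_div_cos]
      generalize k * (t - (a + b) / 2) = θ at h2 h3 ⊢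
      field_simp
      rw [add_comm, h3]
    have hqc : ContinuousOn q (Set.uIcc a b) := by
      rw [Set.uIcc_of_le hab.le]
      exact fun t ht => (hqd t ht).continuousAt.continuousWithinAt
    set N' : ℝ → ℝ := fun t =>
      (k ^ 2 + q t ^ 2) * ‖f t‖ ^ 2 + q t * (2 * inner ℝ (f t) (f' t)) with hN'
    have hN'c : ContinuousOn N' (Set.uIcc a b) := by
      have h1 : Continuous fun t => inner ℝ (f t) (f' t) := hfc.inner hf'
      fun_prop
    have hFTC : ∫ t in a..b, N' t = 0 := by
      rw [intervalIntegral.integral_eq_sub_of_hasDerivAt (f := fun t => q t * ‖f t‖ ^ 2)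
        (fun t ht => ?_) hN'c.intervalIntegrable]
      · simp [ha, hb]
      · rw [Set.uIcc_of_le hab.le] at ht
        exact (hqd t ht).mul (hf t).norm_sq
    have hpt : ∀ t, ‖f' t + q t • f t‖ ^ 2 = (‖f' t‖ ^ 2 - k ^ 2 * ‖f t‖ ^ 2) + N' t := by
      intro t
      rw [norm_add_sq_real, inner_smul_right, norm_smul, mul_pow, Real.norm_eq_abs, sq_abs,
        real_inner_comm]
      simp only [hN']
      ring
    have hnonneg : 0 ≤ ∫ t in a..b, ‖f' t + q t • f t‖ ^ 2 :=
      intervalIntegral.integral_nonneg hab.le fun t _ => sq_nonneg _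
    simp only [hpt] at hnonneg
    have i1 : IntervalIntegrable (fun t => ‖f' t‖ ^ 2) volume a b :=
      (hf'.norm.pow 2).intervalIntegrable _ _
    have i2 : IntervalIntegrable (fun t => k ^ 2 * ‖f t‖ ^ 2) volume a b :=
      (continuous_const.mul (hfc.norm.pow 2)).intervalIntegrable _ _
    rw [intervalIntegral.integral_add (i1.sub i2) hN'c.intervalIntegrable,
      intervalIntegral.integral_sub i1 i2, hFTC, intervalIntegral.integral_const_mul] at hnonneg
    linarith
  have hlim : Tendsto (fun k : ℝ => k ^ 2 * ∫ t in a..b, ‖f t‖ ^ 2)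
      (𝓝[<] (Real.pi / (b - a))) (𝓝 ((Real.pi / (b - a)) ^ 2 * ∫ t in a..b, ‖f t‖ ^ 2)) :=
    Tendsto.mono_left (Continuous.tendsto (by fun_prop) _) nhdsWithin_le_nhds
  exact le_of_tendsto hlim (Filter.eventually_of_mem
    (Ioo_mem_nhdsLT (div_pos Real.pi_pos hba)) key)

theorem hasDerivAt_slice_antidiag {w : ℝ × ℝ → ℂ} (hw : Differentiable ℝ w) (s x : ℝ) :
    HasDerivAt (fun x => w (x, s - x)) (dx w (x, s - x) - dy w (x, s - x)) x := by
  have h := (hw (x, s - x)).hasFDerivAt.comp_hasDerivAt x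
    ((hasDerivAt_id x).prodMk ((hasDerivAt_id x).const_sub s))
  refine h.congr_deriv ?_
  rw [dx, dy, ← map_sub]
  congr 1
  simp

/-- Integration over the plane along the lines `x + y = s`. -/
theorem integral_eq_integral_antidiag {F : ℝ × ℝ → ℝ} (hF : Continuous F)
    (hFc : HasCompactSupport F) :
    Integrable (fun s => ∫ x, F (x, s - x)) ∧ ∫ p, F p = ∫ s, ∫ x, F (x, s - x) := by
  have hemb : IsClosedEmbedding fun p : ℝ × ℝ => (p.1, p.2 - p.1) := by
    refine Topology.IsClosedEmbedding.of_continuous_injective_isClosedMap (by fun_prop) ?_ ?_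
    · rintro ⟨x, y⟩ ⟨x', y'⟩ h
      simp only [Prod.mk.injEq] at h
      ext <;> simp <;> linarith [h.1, h.2]
    · exact (Homeomorph.mk ⟨fun p : ℝ × ℝ => (p.1, p.2 - p.1), fun p => (p.1, p.2 + p.1),
        fun p => by simp, fun p => by simp⟩ (by fun_prop) (by fun_prop)).isClosedMap
  have hint : Integrable (fun p : ℝ × ℝ => F (p.1, p.2 - p.1)) (volume.prod volume) :=
    (Continuous.integrable_of_hasCompactSupport (by fun_prop)
      (hFc.comp_isClosedEmbedding hemb))
  refine ⟨hint.integral_prod_right, ?_⟩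
  rw [Measure.volume_eq_prod, integral_prod _ (hF.integrable_of_hasCompactSupport hFc)]
  rw [← integral_integral_swap (f := fun x s => F (x, s - x)) hint]
  refine integral_congr_ae (Eventually.of_forall fun x => ?_)
  exact (integral_sub_right_eq_self (fun y => F (x, y)) x).symm

theorem IsCore.setIntegral_eq_integral {U Ω : Set (ℝ × ℝ)} {u : ℝ × ℝ → ℂ} (hu : IsCore U u)
    (hU : U ⊆ Ω) : ∫ p in Ω, ‖u p‖ ^ 2 = ∫ p, ‖u p‖ ^ 2 ∧
      ∫ p in Ω, (‖dx u p‖ ^ 2 + ‖dy u p‖ ^ 2) = ∫ p, (‖dx u p‖ ^ 2 + ‖dy u p‖ ^ 2) :=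
  ⟨setIntegral_eq_integral_of_forall_compl_eq_zero fun p hp => by
      simp [hu.eq_zero fun h => hp (hU h)],
    setIntegral_eq_integral_of_forall_compl_eq_zero fun p hp => by
      simp [hu.dx_eq_zero fun h => hp (hU h), hu.dy_eq_zero fun h => hp (hU h)]⟩

theorem IsCore.continuous_energy {U : Set (ℝ × ℝ)} {u : ℝ × ℝ → ℂ} (hu : IsCore U u) :
    Continuous fun p => ‖dx u p‖ ^ 2 + ‖dy u p‖ ^ 2 := by
  have := hu.continuous_dx
  have := hu.continuous_dy
  fun_prop

theorem IsCore.hasCompactSupport_energy {U : Set (ℝ × ℝ)} {u : ℝ × ℝ → ℂ} (hu : IsCore U u) :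
    HasCompactSupport fun p => ‖dx u p‖ ^ 2 + ‖dy u p‖ ^ 2 :=
  (hu.hasCompactSupport_dx.comp_left (g := fun z : ℂ => ‖z‖ ^ 2) (by simp)).add
    (hu.hasCompactSupport_dy.comp_left (g := fun z : ℂ => ‖z‖ ^ 2) (by simp))

theorem IsCore.diag {U : Set (ℝ × ℝ)} {u : ℝ × ℝ → ℂ} (hu : IsCore U u) (x : ℝ) :
    u (x, x) = 0 :=
  self_eq_neg.1 (hu.2.2.2 x x)

/-- With Dirichlet conditions at the end point the form is at least `2π²/d²`: on each line
`x + y = s` an antisymmetric function vanishes at `x - y = 0` and at `x - y = ± d`. -/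
theorem energy_ge_dirichlet {d : ℝ} (hd : 0 < d) {u : ℝ × ℝ → ℂ}
    (hu : IsCore (support .dirichlet d) u) :
    2 * Real.pi ^ 2 / d ^ 2 * ∫ p in config d, ‖u p‖ ^ 2 ≤
      ∫ p in config d, (‖dx u p‖ ^ 2 + ‖dy u p‖ ^ 2) := by
  have hsub : support .dirichlet d ⊆ config d := fun p hp =>
    ⟨hp.2.1.le, hp.2.2.le, le_of_lt hp.1⟩
  have hcu := hu.1.continuous
  have hdx := hu.continuous_dx
  have hdy := hu.continuous_dy
  rw [(hu.setIntegral_eq_integral hsub).1, (hu.setIntegral_eq_integral hsub).2]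
  obtain ⟨i1, e1⟩ := integral_eq_integral_antidiag (F := fun p => ‖u p‖ ^ 2) (by fun_prop)
    (hu.2.1.comp_left (g := fun z : ℂ => ‖z‖ ^ 2) (by simp))
  obtain ⟨i2, e2⟩ := integral_eq_integral_antidiag hu.continuous_energy
    hu.hasCompactSupport_energy
  rw [e1, e2, ← integral_const_mul]
  refine integral_mono (i1.const_mul _) i2 fun s => ?_
  dsimp only
  set g : ℝ → ℂ := fun x => u (x, s - x) with hg
  set g' : ℝ → ℂ := fun x => dx u (x, s - x) - dy u (x, s - x) with hg'
  have hgd : ∀ x, HasDerivAt g (g' x) x := hasDerivAt_slice_antidiag hu.differentiable s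
  have hgc : Continuous g := by fun_prop
  have hg'c : Continuous g' := by fun_prop
  have hout : ∀ x, x ∉ Set.Ioo ((s - d) / 2) ((s + d) / 2) → (x, s - x) ∉ support .dirichlet d := by
    intro x hx hmem
    have := abs_lt.1 (show |x - (s - x)| < d from hmem.1)
    exact hx ⟨by linarith, by linarith⟩
  have hsupp : ∀ F : ℝ → ℝ, (∀ x, (x, s - x) ∉ support .dirichlet d → F x = 0) →
      ∫ x, F x = ∫ x in ((s - d) / 2)..((s + d) / 2), F x := by
    intro F hF
    refine (intervalIntegral.integral_eq_integral_of_support_subset fun x hx => ?_).symm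
    by_contra h
    exact hx (hF x (hout x fun h' => h (Set.Ioo_subset_Ioc_self h')))
  have hen : Continuous fun x => ‖dx u (x, s - x)‖ ^ 2 + ‖dy u (x, s - x)‖ ^ 2 := by fun_prop
  rw [hsupp _ fun x hx => by simp [hu.eq_zero hx],
    hsupp _ fun x hx => by simp [hu.dx_eq_zero hx, hu.dy_eq_zero hx]]
  have z1 : g ((s - d) / 2) = 0 := hu.eq_zero (hout _ (by simp))
  have z2 : g ((s + d) / 2) = 0 := hu.eq_zero (hout _ (by simp))
  have z0 : g (s / 2) = 0 := by
    have := hu.diag (s / 2)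
    simpa only [hg, sub_half] using this
  have w1 := wirtinger_dirichlet hgd hg'c (show (s - d) / 2 < s / 2 by linarith) z1 z0
  have w2 := wirtinger_dirichlet hgd hg'c (show s / 2 < (s + d) / 2 by linarith) z0 z2
  rw [show s / 2 - (s - d) / 2 = d / 2 by ring] at w1
  rw [show (s + d) / 2 - s / 2 = d / 2 by ring] at w2
  have a1 := intervalIntegral.integral_add_adjacent_intervals
    ((hgc.norm.pow 2).intervalIntegrable (μ := volume) ((s - d) / 2) (s / 2))
    ((hgc.norm.pow 2).intervalIntegrable (μ := volume) (s / 2) ((s + d) / 2))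
  have a2 := intervalIntegral.integral_add_adjacent_intervals
    ((hg'c.norm.pow 2).intervalIntegrable (μ := volume) ((s - d) / 2) (s / 2))
    ((hg'c.norm.pow 2).intervalIntegrable (μ := volume) (s / 2) ((s + d) / 2))
  have hle : ∫ x in ((s - d) / 2)..((s + d) / 2), ‖g' x‖ ^ 2 ≤
      ∫ x in ((s - d) / 2)..((s + d) / 2),
        2 * (‖dx u (x, s - x)‖ ^ 2 + ‖dy u (x, s - x)‖ ^ 2) := by
    refine intervalIntegral.integral_mono (by linarith)
      ((hg'c.norm.pow 2).intervalIntegrable _ _)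
      ((continuous_const.mul hen).intervalIntegrable _ _) fun x => ?_
    exact (pow_le_pow_left₀ (norm_nonneg _) (norm_sub_le _ _) 2).trans add_sq_le
  rw [intervalIntegral.integral_const_mul] at hle
  simp only [Pi.pow_apply] at a1 a2
  have e : (Real.pi / (d / 2)) ^ 2 = 2 * (2 * Real.pi ^ 2 / d ^ 2) := by field_simp
  rw [e] at w1 w2
  have : (2 * (2 * Real.pi ^ 2 / d ^ 2)) * ∫ x in ((s - d) / 2)..((s + d) / 2), ‖g x‖ ^ 2 ≤
      ∫ x in ((s - d) / 2)..((s + d) / 2), ‖g' x‖ ^ 2 := by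
    rw [← a1, ← a2, mul_add]
    exact add_le_add w1 w2
  simp only [hg] at this
  linarith

/-- With Neumann conditions at the end point the form is still bounded below by a positive
constant, because antisymmetric functions vanish on the diagonal. -/
theorem energy_ge_neumann {d : ℝ} (hd : 0 < d) {u : ℝ × ℝ → ℂ}
    (hu : IsCore (support .neumann d) u) :
    1 / (4 * d ^ 2) * ∫ p in config d, ‖u p‖ ^ 2 ≤
      ∫ p in config d, (‖dx u p‖ ^ 2 + ‖dy u p‖ ^ 2) := by
  set Q : Set (ℝ × ℝ) := Set.Ici 0 ×ˢ Set.Ici 0 with hQ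
  have hcu := hu.1.continuous
  have hdx := hu.continuous_dx
  have hdy := hu.continuous_dy
  have hsub : config d ⊆ Q := fun p hp => ⟨hp.1, hp.2.1⟩
  have hQm : MeasurableSet Q := measurableSet_Ici.prod measurableSet_Ici
  have hout : ∀ p ∈ Q \ config d, p ∉ support .neumann d := fun p hp hps =>
    hp.2 ⟨hp.1.1, hp.1.2, le_of_lt hps.1⟩
  rw [← setIntegral_eq_of_subset_of_forall_sdiff_eq_zero hQm hsub fun p hp => by
      simp [hu.eq_zero (hout p hp)],
    ← setIntegral_eq_of_subset_of_forall_sdiff_eq_zero hQm hsub fun p hp => by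
      simp [hu.dx_eq_zero (hout p hp), hu.dy_eq_zero (hout p hp)]]
  have i1 : Integrable (fun p => ‖u p‖ ^ 2)
      ((volume.restrict (Set.Ici (0 : ℝ))).prod (volume.restrict (Set.Ici (0 : ℝ)))) := by
    rw [Measure.prod_restrict]
    exact (Continuous.integrable_of_hasCompactSupport (by fun_prop)
      (hu.2.1.comp_left (g := fun z : ℂ => ‖z‖ ^ 2) (by simp))).integrableOn
  have i2 : Integrable (fun p => ‖dx u p‖ ^ 2 + ‖dy u p‖ ^ 2)
      ((volume.restrict (Set.Ici (0 : ℝ))).prod (volume.restrict (Set.Ici (0 : ℝ)))) := by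
    rw [Measure.prod_restrict]
    exact (hu.continuous_energy.integrable_of_hasCompactSupport
      hu.hasCompactSupport_energy).integrableOn
  have hvol : volume.restrict Q =
      (volume.restrict (Set.Ici (0 : ℝ))).prod (volume.restrict (Set.Ici (0 : ℝ))) := by
    rw [Measure.prod_restrict]; rfl
  rw [hvol, integral_prod_symm _ i1, integral_prod_symm _ i2, ← integral_const_mul]
  refine setIntegral_mono_on (i1.integral_prod_right.const_mul _) i2.integral_prod_right
    measurableSet_Ici fun y hy => ?_
  have hy0 : 0 ≤ y := hy
  set a := max 0 (y - d) with ha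
  set b := y + d with hb
  have hay : a ≤ y := max_le hy0 (by linarith)
  have hab : b - a ≤ 2 * d := by
    have : y - d ≤ a := le_max_right _ _
    linarith
  have hIcc : Set.Icc a b ⊆ Set.Ici 0 := fun x hx => (le_max_left _ _).trans hx.1
  set A := ∫ x in Set.Ici (0 : ℝ), (‖dx u (x, y)‖ ^ 2 + ‖dy u (x, y)‖ ^ 2) with hA
  have hslice : Integrable fun x => ‖dx u (x, y)‖ ^ 2 + ‖dy u (x, y)‖ ^ 2 := by
    have hc : IsClosedEmbedding fun x : ℝ => (x, y) :=
      (Isometry.of_dist_eq fun x x' => by simp [Prod.dist_eq]).isClosedEmbedding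
    exact Continuous.integrable_of_hasCompactSupport (by fun_prop)
      (hu.hasCompactSupport_energy.comp_isClosedEmbedding hc)
  have hA0 : 0 ≤ A := integral_nonneg fun x => by positivity
  have hdxA : ∫ x in Set.Ioc a b, ‖dx u (x, y)‖ ^ 2 ≤ A := by
    refine le_trans (setIntegral_mono (Continuous.integrableOn_Ioc (by fun_prop))
      hslice.integrableOn fun x => ?_) (setIntegral_mono_set hslice.integrableOn
        (Eventually.of_forall fun x => by dsimp only; positivity)
        (Set.Ioc_subset_Icc_self.trans hIcc).eventuallyLE)
    simp
  have hpt : ∀ x ∈ Set.Icc a b, ‖u (x, y)‖ ^ 2 ≤ 2 * d * A := by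
    intro x hx
    have h := norm_sub_sq_le_integral (hasDerivAt_slice_fst hu.differentiable y) (by fun_prop) hx
      (show y ∈ Set.Icc a b from ⟨hay, by linarith⟩)
    rw [hu.diag y, sub_zero] at h
    refine h.trans ?_
    gcongr
  have hle : ∫ x in Set.Ici (0 : ℝ), ‖u (x, y)‖ ^ 2 ≤ 4 * d ^ 2 * A := by
    rw [setIntegral_eq_of_subset_of_forall_sdiff_eq_zero measurableSet_Ici hIcc fun x hx => ?_]
    · calc ∫ x in Set.Icc a b, ‖u (x, y)‖ ^ 2 ≤ ∫ _x in Set.Icc a b, 2 * d * A :=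
            setIntegral_mono_on (Continuous.integrableOn_Icc (by fun_prop))
              continuous_const.integrableOn_Icc measurableSet_Icc hpt
        _ = (b - a) * (2 * d * A) := by
            rw [setIntegral_const, Real.volume_real_Icc_of_le (by linarith), smul_eq_mul]
        _ ≤ (2 * d) * (2 * d * A) := by gcongr
        _ = _ := by ring
    · have : (x, y) ∉ support .neumann d := by
        intro hmem
        have h1 := abs_lt.1 (show |x - y| < d from hmem.1)
        exact hx.2 ⟨max_le hx.1 (by linarith), by linarith⟩
      simp [hu.eq_zero this]
  rw [one_div, inv_mul_le_iff₀ (by positivity)]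
  exact hle

theorem bddBelow_energies (edge : EdgeCondition) (d : ℝ) :
    BddBelow {E : ℝ | ∃ u, IsCore (support edge d) u ∧ ∫ p in config d, ‖u p‖ ^ 2 = 1 ∧
      E = ∫ p in config d, (‖dx u p‖ ^ 2 + ‖dy u p‖ ^ 2)} := by
  refine ⟨0, ?_⟩
  rintro _ ⟨u, _, _, rfl⟩
  exact integral_nonneg fun p => by positivity

theorem IsCore.exists_normalized {U Ω : Set (ℝ × ℝ)} {u : ℝ × ℝ → ℂ} (hu : IsCore U u)
    (hu0 : 0 < ∫ p in Ω, ‖u p‖ ^ 2) :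
    ∃ v, IsCore U v ∧ ∫ p in Ω, ‖v p‖ ^ 2 = 1 ∧
      ∫ p in Ω, (‖dx v p‖ ^ 2 + ‖dy v p‖ ^ 2) =
        (∫ p in Ω, ‖u p‖ ^ 2)⁻¹ * ∫ p in Ω, (‖dx u p‖ ^ 2 + ‖dy u p‖ ^ 2) := by
  set I := ∫ p in Ω, ‖u p‖ ^ 2 with hI
  set c : ℂ := (((√I)⁻¹ : ℝ) : ℂ) with hc
  have hcn : ‖c‖ ^ 2 = I⁻¹ := by
    rw [hc, Complex.norm_real, Real.norm_of_nonneg (by positivity), inv_pow, Real.sq_sqrt hu0.le]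
  refine ⟨c • u, hu.const_smul c, ?_, ?_⟩
  · simp only [Pi.smul_apply, norm_smul, mul_pow, hcn, integral_const_mul]
    rw [← hI, inv_mul_cancel₀ hu0.ne']
  · rw [← integral_const_mul]
    congr 1
    ext p
    simp only [dx, dy, fderiv_const_smul (hu.differentiable p)]
    simp only [smul_apply, norm_smul, mul_pow, hcn]
    ring

/-- The variational characterisation of `E_0`, without normalisation. -/
theorem bottomEnergy_mul_le {edge : EdgeCondition} {d : ℝ} {u : ℝ × ℝ → ℂ}
    (hu : IsCore (support edge d) u) :
    bottomEnergy edge d * ∫ p in config d, ‖u p‖ ^ 2 ≤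
      ∫ p in config d, (‖dx u p‖ ^ 2 + ‖dy u p‖ ^ 2) := by
  have hI0 : 0 ≤ ∫ p in config d, ‖u p‖ ^ 2 := integral_nonneg fun p => by positivity
  rcases hI0.eq_or_lt with h0 | h0
  · rw [← h0, mul_zero]
    exact integral_nonneg fun p => by positivity
  obtain ⟨v, hv, hv1, hve⟩ := hu.exists_normalized h0
  have := csInf_le (bddBelow_energies edge d) ⟨v, hv, hv1, rfl⟩
  rw [hve] at this
  rw [mul_comm, ← le_inv_mul_iff₀ h0]
  exact this

/-- `E_0` is a lower bound for the eigenvalues on every `Ω_L`, since the core of `Ω_L` is part of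
the core of `Ω`. -/
theorem bottomEnergy_le_of_isEigenvector {edge : EdgeCondition} {d L e : ℝ}
    {u : Lp ℂ 2 (volume.restrict (configBox d L))}
    (hu : IsEigenvector (configBox d L) (supportBox edge d L) e u) (hu1 : ‖u‖ = 1) :
    bottomEnergy edge d ≤ e := by
  refine le_of_isEigenvector (fun w hw => ?_) hu hu1
  have hsub : configBox d L ⊆ config d := fun p hp => hp.1
  have hout : ∀ p ∈ config d \ configBox d L, p ∉ supportBox edge d L := fun p hp hps =>
    hp.2 ⟨hp.1, hps.2.1.le, hps.2.2.le⟩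
  rw [← setIntegral_eq_of_subset_of_forall_sdiff_eq_zero (measurableSet_config d) hsub
      fun p hp => by simp [hw.eq_zero (hout p hp)],
    ← setIntegral_eq_of_subset_of_forall_sdiff_eq_zero (measurableSet_config d) hsub
      fun p hp => by simp [hw.dx_eq_zero (hout p hp), hw.dy_eq_zero (hout p hp)]]
  exact bottomEnergy_mul_le (hw.mono Set.inter_subset_left)

end LowerBound

/-! ### Sine modes on an interval -/

section Modes

/-- The `n`-th Dirichlet eigenfunction of the interval `(a, b)`, extended by zero. -/
noncomputable def mode (a b : ℝ) (n : ℕ) : ℝ → ℝ :=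
  (Set.Ioo a b).indicator fun t => Real.sin (n * (Real.pi / (b - a)) * (t - a))

/-- The derivative of `mode a b n` inside `(a, b)`, extended by zero. -/
noncomputable def modeDeriv (a b : ℝ) (n : ℕ) : ℝ → ℝ :=
  (Set.Ioo a b).indicator fun t =>
    n * (Real.pi / (b - a)) * Real.cos (n * (Real.pi / (b - a)) * (t - a))

theorem measurable_mode (a b : ℝ) (n : ℕ) : Measurable (mode a b n) :=
  Measurable.indicator (by fun_prop) measurableSet_Ioo

theorem measurable_modeDeriv (a b : ℝ) (n : ℕ) : Measurable (modeDeriv a b n) :=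
  Measurable.indicator (by fun_prop) measurableSet_Ioo

theorem integral_cos_int_mul {a b : ℝ} (hab : a < b) (l : ℤ) :
    ∫ t in a..b, Real.cos (l * (Real.pi / (b - a)) * (t - a)) = if l = 0 then b - a else 0 := by
  have hba : b - a ≠ 0 := (sub_pos.2 hab).ne'
  split_ifs with h
  · simp [h]
  · set r : ℝ := l * (Real.pi / (b - a)) with hr
    have hr0 : r ≠ 0 := mul_ne_zero (by exact_mod_cast h) (div_ne_zero Real.pi_ne_zero hba)
    have hd : ∀ t ∈ Set.uIcc a b,
        HasDerivAt (fun t => Real.sin (r * (t - a)) / r) (Real.cos (r * (t - a))) t := by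
      intro t _
      have h1 := (((hasDerivAt_id t).sub_const a).const_mul r).sin.div_const r
      refine h1.congr_deriv ?_
      simp only [id]
      field_simp
    rw [intervalIntegral.integral_eq_sub_of_hasDerivAt hd
      (Continuous.intervalIntegrable (by fun_prop) _ _)]
    have : r * (b - a) = l * Real.pi := by rw [hr]; field_simp
    simp [this, Real.sin_int_mul_pi]

theorem integral_indicator_Ioo {a b : ℝ} (hab : a < b) (f : ℝ → ℝ) :
    ∫ t, (Set.Ioo a b).indicator f t = ∫ t in a..b, f t := by
  rw [integral_indicator measurableSet_Ioo, intervalIntegral.integral_of_le hab.le,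
    integral_Ioc_eq_integral_Ioo]

theorem integral_mode_mul_mode {a b : ℝ} (hab : a < b) {n m : ℕ} (hn : n ≠ 0) :
    ∫ t, mode a b n t * mode a b m t = if n = m then (b - a) / 2 else 0 := by
  have h1 : ∀ t, mode a b n t * mode a b m t = (Set.Ioo a b).indicator (fun t =>
      (Real.cos (((n : ℤ) - m : ℤ) * (Real.pi / (b - a)) * (t - a)) -
        Real.cos (((n : ℤ) + m : ℤ) * (Real.pi / (b - a)) * (t - a))) / 2) t := by
    intro t
    by_cases ht : t ∈ Set.Ioo a b
    · simp only [mode, Set.indicator_of_mem ht]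
      push_cast
      rw [sub_mul, sub_mul, add_mul, add_mul, Real.cos_sub, Real.cos_add]
      ring
    · simp [mode, Set.indicator_of_notMem ht]
  simp only [h1]
  rw [integral_indicator_Ioo hab, intervalIntegral.integral_div, intervalIntegral.integral_sub
    (Continuous.intervalIntegrable (by fun_prop) _ _)
    (Continuous.intervalIntegrable (by fun_prop) _ _), integral_cos_int_mul hab,
    integral_cos_int_mul hab, if_neg (show ((n : ℤ) + m) ≠ 0 by omega)]
  by_cases h : n = m
  · simp [h]
  · rw [if_neg h, if_neg (by omega)]; simp

theorem integral_modeDeriv_mul_modeDeriv {a b : ℝ} (hab : a < b) {n m : ℕ} (hn : n ≠ 0) :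
    ∫ t, modeDeriv a b n t * modeDeriv a b m t =
      if n = m then (n * (Real.pi / (b - a))) ^ 2 * ((b - a) / 2) else 0 := by
  have h1 : ∀ t, modeDeriv a b n t * modeDeriv a b m t = (Set.Ioo a b).indicator (fun t =>
      n * (Real.pi / (b - a)) * (m * (Real.pi / (b - a))) *
      ((Real.cos (((n : ℤ) - m : ℤ) * (Real.pi / (b - a)) * (t - a)) +
        Real.cos (((n : ℤ) + m : ℤ) * (Real.pi / (b - a)) * (t - a))) / 2)) t := by
    intro t
    by_cases ht : t ∈ Set.Ioo a b
    · simp only [modeDeriv, Set.indicator_of_mem ht]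
      push_cast
      rw [sub_mul, sub_mul, add_mul (n : ℝ), add_mul _ _ (t - a), Real.cos_sub, Real.cos_add]
      ring
    · simp [modeDeriv, Set.indicator_of_notMem ht]
  simp only [h1]
  rw [integral_indicator_Ioo hab, intervalIntegral.integral_const_mul,
    intervalIntegral.integral_div, intervalIntegral.integral_add
    (Continuous.intervalIntegrable (by fun_prop) _ _)
    (Continuous.intervalIntegrable (by fun_prop) _ _), integral_cos_int_mul hab,
    integral_cos_int_mul hab, if_neg (show ((n : ℤ) + m) ≠ 0 by omega)]
  by_cases h : n = m
  · subst h
    simp only [sub_self, if_true, add_zero]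
    ring
  · rw [if_neg h, if_neg (by omega)]; simp

theorem abs_sin_nat_mul_le (n : ℕ) (x : ℝ) : |Real.sin (n * x)| ≤ n * |Real.sin x| := by
  induction n with
  | zero => simp
  | succ n ih =>
    push_cast
    rw [add_mul, one_mul, Real.sin_add]
    calc |Real.sin (n * x) * Real.cos x + Real.cos (n * x) * Real.sin x|
        ≤ |Real.sin (n * x)| * |Real.cos x| + |Real.cos (n * x)| * |Real.sin x| := by
          rw [← abs_mul, ← abs_mul]; exact abs_add_le _ _
      _ ≤ n * |Real.sin x| * 1 + 1 * |Real.sin x| := by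
          gcongr
          · exact Real.abs_cos_le_one _
          · exact Real.abs_cos_le_one _
      _ = (n + 1) * |Real.sin x| := by ring

/-- A smooth function that is `0` on `(-∞, 1]` and `1` on `[2, ∞)`. -/
noncomputable def cutoff (v : ℝ) : ℝ := Real.smoothTransition (v - 1)

theorem contDiff_cutoff : ContDiff ℝ ∞ cutoff :=
  Real.smoothTransition.contDiff.comp (contDiff_id.sub contDiff_const)

theorem cutoff_eq_zero {v : ℝ} (hv : v ≤ 1) : cutoff v = 0 :=
  Real.smoothTransition.zero_of_nonpos (by linarith)

theorem cutoff_eq_one {v : ℝ} (hv : 2 ≤ v) : cutoff v = 1 :=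
  Real.smoothTransition.one_of_one_le (by linarith)

theorem abs_cutoff_le (v : ℝ) : |cutoff v| ≤ 1 := by
  rw [cutoff, abs_of_nonneg (Real.smoothTransition.nonneg _)]
  exact Real.smoothTransition.le_one _

theorem deriv_cutoff_of_two_lt {v : ℝ} (hv : 2 < v) : deriv cutoff v = 0 := by
  have : cutoff =ᶠ[𝓝 v] fun _ => 1 := by
    filter_upwards [lt_mem_nhds hv] with x hx using cutoff_eq_one hx.le
  rw [this.deriv_eq, deriv_const]

theorem deriv_cutoff_of_lt_one {v : ℝ} (hv : v < 1) : deriv cutoff v = 0 := by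
  have : cutoff =ᶠ[𝓝 v] fun _ => 0 := by
    filter_upwards [gt_mem_nhds hv] with x hx using cutoff_eq_zero (le_of_lt hx)
  rw [this.deriv_eq, deriv_const]

theorem exists_bound_mul_deriv_cutoff : ∃ M, 0 ≤ M ∧ ∀ v, |v * deriv cutoff v| ≤ M := by
  have hc : Continuous fun v => |v * deriv cutoff v| :=
    (continuous_id.mul (contDiff_cutoff.continuous_deriv (by simp))).abs
  obtain ⟨M, hM⟩ := (isCompact_Icc (a := (1 : ℝ)) (b := 2)).bddAbove_image hc.continuousOn
  refine ⟨max M 0, le_max_right _ _, fun v => ?_⟩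
  by_cases h1 : v < 1
  · simp [deriv_cutoff_of_lt_one h1]
  by_cases h2 : 2 < v
  · simp [deriv_cutoff_of_two_lt h2]
  exact (hM ⟨v, ⟨not_lt.1 h1, not_lt.1 h2⟩, rfl⟩).trans (le_max_left _ _)

/-- Smooth approximation of `mode a b n` with compact support in `(a, b)`: the mode is cut off
where the first mode is below `1 / j`. -/
noncomputable def cutMode (a b : ℝ) (n j : ℕ) : ℝ → ℝ :=
  fun t => mode a b n t * cutoff (j * mode a b 1 t)

variable {a b : ℝ}

theorem cutMode_eventually_zero (n j : ℕ) {t : ℝ} (ht : t ∉ Set.Ioo a b) :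
    cutMode a b n j =ᶠ[𝓝 t] 0 := by
  set g : ℝ → ℝ := fun t => Real.sin ((1 : ℕ) * (Real.pi / (b - a)) * (t - a)) with hg
  have hout : ∀ x, x ∉ Set.Ioo a b → cutMode a b n j x = 0 := fun x hx => by
    simp [cutMode, mode, Set.indicator_of_notMem hx]
  by_cases hcl : t ∈ Set.Icc a b
  · have hg0 : j * g t < 1 := by
      have : g t = 0 := by
        rcases Set.eq_endpoints_or_mem_Ioo_of_mem_Icc hcl with h | h | h
        · simp [hg, h]
        · by_cases hab : b - a = 0
          · simp [hg, h, hab]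
          · simp [hg, h, div_mul_cancel₀ _ hab]
        · exact absurd h ht
      simp [this]
    have hgc : Continuous fun x => j * g x := by fun_prop
    filter_upwards [hgc.continuousAt.eventually_lt continuousAt_const hg0] with x hx
    by_cases hxI : x ∈ Set.Ioo a b
    · have : mode a b 1 x = g x := by simp [mode, hg, Set.indicator_of_mem hxI]
      simp [cutMode, this, cutoff_eq_zero hx.le]
    · exact hout x hxI
  · filter_upwards [isClosed_Icc.isOpen_compl.mem_nhds hcl] with x hx
    exact hout x fun h => hx (Set.Ioo_subset_Icc_self h)

theorem tsupport_cutMode (n j : ℕ) : tsupport (cutMode a b n j) ⊆ Set.Ioo a b := by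
  intro t ht
  by_contra h
  exact notMem_tsupport_iff_eventuallyEq.2 (cutMode_eventually_zero n j h) ht

theorem cutMode_eventually_eq (n j : ℕ) {t : ℝ} (ht : t ∈ Set.Ioo a b) :
    cutMode a b n j =ᶠ[𝓝 t] fun t => Real.sin (n * (Real.pi / (b - a)) * (t - a)) *
      cutoff (j * Real.sin ((1 : ℕ) * (Real.pi / (b - a)) * (t - a))) := by
  filter_upwards [isOpen_Ioo.mem_nhds ht] with x hx
  simp only [cutMode, mode, Set.indicator_of_mem hx]

theorem contDiff_cutMode (n j : ℕ) : ContDiff ℝ ∞ (cutMode a b n j) := by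
  rw [contDiff_iff_contDiffAt]
  intro t
  by_cases ht : t ∈ Set.Ioo a b
  · refine ContDiffAt.congr_of_eventuallyEq ?_ (cutMode_eventually_eq n j ht)
    have h1 : ∀ c : ℝ, ContDiff ℝ ∞ fun t => Real.sin (c * (t - a)) := fun c =>
      Real.contDiff_sin.comp (contDiff_const.mul (contDiff_id.sub contDiff_const))
    exact ((h1 _).mul (contDiff_cutoff.comp (contDiff_const.mul (h1 _)))).contDiffAt
  · exact (contDiffAt_const (c := (0 : ℝ))).congr_of_eventuallyEq (cutMode_eventually_zero n j ht)

theorem abs_mode_le (n : ℕ) (t : ℝ) : |mode a b n t| ≤ 1 := by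
  by_cases ht : t ∈ Set.Ioo a b
  · simpa [mode, Set.indicator_of_mem ht] using Real.abs_sin_le_one _
  · simp [mode, Set.indicator_of_notMem ht]

theorem mode_one_pos (hab : a < b) {t : ℝ} (ht : t ∈ Set.Ioo a b) : 0 < mode a b 1 t := by
  have hba : 0 < b - a := sub_pos.2 hab
  simp only [mode, Set.indicator_of_mem ht]
  refine Real.sin_pos_of_pos_of_lt_pi ?_ ?_
  · have := sub_pos.2 ht.1
    have := Real.pi_pos
    positivity
  · rw [Nat.cast_one, one_mul, div_mul_eq_mul_div, div_lt_iff₀ hba]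
    exact mul_lt_mul_of_pos_left (by linarith [ht.2]) Real.pi_pos

theorem abs_cutMode_le (n j : ℕ) (t : ℝ) : |cutMode a b n j t| ≤ 1 := by
  rw [cutMode, abs_mul]
  exact mul_le_one₀ (abs_mode_le n t) (abs_nonneg _) (abs_cutoff_le _)

theorem tendsto_cutMode (hab : a < b) (n : ℕ) (t : ℝ) :
    Tendsto (fun j => cutMode a b n j t) atTop (𝓝 (mode a b n t)) := by
  by_cases ht : t ∈ Set.Ioo a b
  · obtain ⟨J, hJ⟩ := exists_nat_gt (2 / mode a b 1 t)
    have hp := mode_one_pos hab ht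
    refine tendsto_const_nhds.congr' ?_
    filter_upwards [eventually_ge_atTop J] with j hj
    rw [cutMode, cutoff_eq_one, mul_one]
    rw [div_lt_iff₀ hp] at hJ
    exact hJ.le.trans (by gcongr)
  · simp [cutMode, mode, Set.indicator_of_notMem ht]

theorem deriv_cutMode (n j : ℕ) {t : ℝ} (ht : t ∈ Set.Ioo a b) :
    deriv (cutMode a b n j) t = modeDeriv a b n t * cutoff (j * mode a b 1 t) +
      mode a b n t * (deriv cutoff (j * mode a b 1 t) * (j * modeDeriv a b 1 t)) := by
  rw [(cutMode_eventually_eq n j ht).deriv_eq]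
  simp only [mode, modeDeriv, Set.indicator_of_mem ht]
  have h1 : ∀ c : ℝ, HasDerivAt (fun t => Real.sin (c * (t - a))) (c * Real.cos (c * (t - a))) t :=
    fun c => (((hasDerivAt_id t).sub_const a).const_mul c).sin.congr_deriv (by simp [mul_comm])
  have h2 := ((contDiff_cutoff.differentiable (by simp))
    (j * Real.sin ((1 : ℕ) * (Real.pi / (b - a)) * (t - a)))).hasDerivAt.comp t
      ((h1 ((1 : ℕ) * (Real.pi / (b - a)))).const_mul (j : ℝ))
  exact ((h1 _).mul h2).deriv

theorem deriv_cutMode_of_notMem (n j : ℕ) {t : ℝ} (ht : t ∉ Set.Ioo a b) :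
    deriv (cutMode a b n j) t = 0 := by
  rw [(cutMode_eventually_zero n j ht).deriv_eq]
  exact deriv_const t 0

/-- The derivatives of the approximations are bounded uniformly: where the cutoff varies, the
`n`-th mode is at most `n` times the first one. -/
theorem exists_bound_deriv_cutMode (hab : a < b) (n : ℕ) :
    ∃ M, ∀ j t, |deriv (cutMode a b n j) t| ≤ M := by
  obtain ⟨M, hM0, hM⟩ := exists_bound_mul_deriv_cutoff
  set c := Real.pi / (b - a) with hc
  have hc0 : 0 ≤ c := div_nonneg Real.pi_pos.le (sub_pos.2 hab).le
  refine ⟨n * c + n * M * c, fun j t => ?_⟩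
  by_cases ht : t ∈ Set.Ioo a b
  · rw [deriv_cutMode n j ht]
    have hd : ∀ m : ℕ, |modeDeriv a b m t| ≤ m * c := by
      intro m
      simp only [modeDeriv, Set.indicator_of_mem ht, abs_mul, Nat.abs_cast, ← hc,
        abs_of_nonneg hc0]
      exact mul_le_of_le_one_right (by positivity) (Real.abs_cos_le_one _)
    have hS : |mode a b n t| ≤ n * |mode a b 1 t| := by
      simp only [mode, Set.indicator_of_mem ht]
      rw [mul_assoc, mul_assoc, Nat.cast_one, one_mul]
      exact abs_sin_nat_mul_le n _
    refine (abs_add_le _ _).trans (add_le_add ?_ ?_)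
    · rw [abs_mul]
      exact (mul_le_of_le_one_right (abs_nonneg _) (abs_cutoff_le _)).trans (hd n)
    · have hd1 := hd 1
      rw [Nat.cast_one, one_mul] at hd1
      calc |mode a b n t * (deriv cutoff (j * mode a b 1 t) * (j * modeDeriv a b 1 t))|
          = |mode a b n t| * (|deriv cutoff (j * mode a b 1 t)| * (j * |modeDeriv a b 1 t|)) := by
            simp only [abs_mul, Nat.abs_cast]
        _ ≤ n * |mode a b 1 t| * (|deriv cutoff (j * mode a b 1 t)| * (j * c)) := by gcongr
        _ = n * |j * mode a b 1 t * deriv cutoff (j * mode a b 1 t)| * c := by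
            simp only [abs_mul, Nat.abs_cast]; ring
        _ ≤ n * M * c := by gcongr; exact hM _
  · rw [deriv_cutMode_of_notMem n j ht, abs_zero]
    positivity

theorem tendsto_deriv_cutMode (hab : a < b) (n : ℕ) (t : ℝ) :
    Tendsto (fun j => deriv (cutMode a b n j) t) atTop (𝓝 (modeDeriv a b n t)) := by
  by_cases ht : t ∈ Set.Ioo a b
  · obtain ⟨J, hJ⟩ := exists_nat_gt (2 / mode a b 1 t)
    have hp := mode_one_pos hab ht
    refine tendsto_const_nhds.congr' ?_
    filter_upwards [eventually_ge_atTop J] with j hj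
    rw [div_lt_iff₀ hp] at hJ
    have h2 : 2 < j * mode a b 1 t := hJ.trans_le (by gcongr)
    rw [deriv_cutMode n j ht, cutoff_eq_one h2.le, deriv_cutoff_of_two_lt h2]
    ring
  · simp [deriv_cutMode_of_notMem n _ ht, modeDeriv, Set.indicator_of_notMem ht]

/-- Even modes of a symmetric interval are odd functions. -/
theorem mode_neg {d : ℝ} (hd : 0 < d) (n : ℕ) (t : ℝ) :
    mode (-d) d (2 * n) (-t) = -mode (-d) d (2 * n) t := by
  by_cases ht : t ∈ Set.Ioo (-d) d
  · have ht' : -t ∈ Set.Ioo (-d) d := ⟨by linarith [ht.2], by linarith [ht.1]⟩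
    simp only [mode, Set.indicator_of_mem ht, Set.indicator_of_mem ht']
    rw [← Real.sin_neg, ← Real.sin_sub_nat_mul_two_pi _ n]
    congr 1
    push_cast
    field_simp
    ring
  · have ht' : -t ∉ Set.Ioo (-d) d := fun h => ht ⟨by linarith [h.2], by linarith [h.1]⟩
    simp [mode, Set.indicator_of_notMem ht, Set.indicator_of_notMem ht']

theorem mode_one_neg {d : ℝ} (hd : 0 < d) (t : ℝ) : mode (-d) d 1 (-t) = mode (-d) d 1 t := by
  by_cases ht : t ∈ Set.Ioo (-d) d
  · have ht' : -t ∈ Set.Ioo (-d) d := ⟨by linarith [ht.2], by linarith [ht.1]⟩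
    simp only [mode, Set.indicator_of_mem ht, Set.indicator_of_mem ht']
    rw [← Real.sin_pi_sub]
    congr 1
    push_cast
    field_simp
    ring
  · have ht' : -t ∉ Set.Ioo (-d) d := fun h => ht ⟨by linarith [h.2], by linarith [h.1]⟩
    simp [mode, Set.indicator_of_notMem ht, Set.indicator_of_notMem ht']

theorem cutMode_neg {d : ℝ} (hd : 0 < d) (n j : ℕ) (t : ℝ) :
    cutMode (-d) d (2 * n) j (-t) = -cutMode (-d) d (2 * n) j t := by
  rw [cutMode, cutMode, mode_neg hd, mode_one_neg hd, neg_mul]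

end Modes

/-! ### Trial functions for the pair on `Ω_L` -/

section Trial

/-- The coordinates `(x - y, x + y)` have Jacobian `2`. -/
theorem map_sub_add_volume :
    Measure.map (fun p : ℝ × ℝ => (p.1 - p.2, p.1 + p.2)) volume =
      ENNReal.ofReal (1 / 2) • (volume : Measure (ℝ × ℝ)) := by
  set T : (ℝ × ℝ) →ₗ[ℝ] ℝ × ℝ := Matrix.toLin (Module.Basis.finTwoProd ℝ)
    (Module.Basis.finTwoProd ℝ) !![1, -1; 1, 1] with hT
  have hdet : LinearMap.det T = 2 := by
    rw [hT, LinearMap.det_toLin, Matrix.det_fin_two_of]; norm_num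
  have hfun : (fun p : ℝ × ℝ => (p.1 - p.2, p.1 + p.2)) = T := by
    ext p
    · simp [hT, Matrix.toLin_finTwoProd_apply, sub_eq_add_neg]
    · simp [hT, Matrix.toLin_finTwoProd_apply]
  rw [hfun, Measure.map_linearMap_addHaar_eq_smul_addHaar volume (by rw [hdet]; norm_num), hdet]
  norm_num

theorem measurableEmbedding_sub_add :
    MeasurableEmbedding fun p : ℝ × ℝ => (p.1 - p.2, p.1 + p.2) :=
  (Homeomorph.mk ⟨fun p : ℝ × ℝ => (p.1 - p.2, p.1 + p.2),
    fun p => ((p.1 + p.2) / 2, (p.2 - p.1) / 2), fun p => by ext <;> simp, fun p => by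
      ext <;> simp <;> ring⟩ (by fun_prop) (by fun_prop)).measurableEmbedding

theorem integral_sub_mul_add (f g : ℝ → ℝ) :
    ∫ p : ℝ × ℝ, f (p.1 - p.2) * g (p.1 + p.2) = 1 / 2 * ((∫ t, f t) * ∫ s, g s) := by
  have h := measurableEmbedding_sub_add.integral_map (μ := volume)
    (fun q : ℝ × ℝ => f q.1 * g q.2)
  rw [map_sub_add_volume, integral_smul_measure] at h
  rw [← h, Measure.volume_eq_prod, integral_prod_mul]
  simp

theorem integrable_sub_mul_add {f g : ℝ → ℝ} (hf : Integrable f) (hg : Integrable g) :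
    Integrable fun p : ℝ × ℝ => f (p.1 - p.2) * g (p.1 + p.2) := by
  have h := (hf.mul_prod hg).smul_measure (c := ENNReal.ofReal (1 / 2)) ENNReal.ofReal_ne_top
  rw [← Measure.volume_eq_prod, ← map_sub_add_volume,
    measurableEmbedding_sub_add.integrable_map_iff] at h
  exact h

/-- Dominated convergence in `L²`. -/
theorem tendsto_eLpNorm_of_bounded {α : Type*} [MeasurableSpace α] {ν : Measure α}
    [IsFiniteMeasure ν] {v : ℕ → α → ℂ} {u : α → ℂ} {M : ℝ} (hv : ∀ j, Measurable (v j))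
    (hb : ∀ j x, ‖v j x‖ ≤ M) (hlim : ∀ x, Tendsto (fun j => v j x) atTop (𝓝 (u x))) :
    MemLp u 2 ν ∧ Tendsto (fun j => eLpNorm (v j - u) 2 ν) atTop (𝓝 0) := by
  have hu : Measurable u := measurable_of_tendsto_metrizable hv (tendsto_pi_nhds.2 hlim)
  have hub : ∀ x, ‖u x‖ ≤ M := fun x =>
    le_of_tendsto (hlim x).norm (Eventually.of_forall fun j => hb j x)
  refine ⟨MemLp.of_bound hu.aestronglyMeasurable M (Eventually.of_forall hub), ?_⟩
  have h1 : Tendsto (fun j => ∫⁻ x, ‖v j x - u x‖ₑ ^ (2 : ℝ) ∂ν) atTop (𝓝 0) := by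
    have h0 : ∫⁻ _x, (0 : ℝ≥0∞) ∂ν = 0 := by simp
    rw [← h0]
    refine tendsto_lintegral_of_dominated_convergence (fun _ => ENNReal.ofReal (2 * M) ^ (2 : ℝ))
      (fun j => (((hv j).sub hu).enorm.pow_const _)) (fun j => Eventually.of_forall fun x => ?_)
      ?_ (Eventually.of_forall fun x => ?_)
    · refine ENNReal.rpow_le_rpow ?_ (by norm_num)
      rw [← ofReal_norm]
      refine ENNReal.ofReal_le_ofReal ?_
      exact (norm_sub_le _ _).trans (by linarith [hb j x, hub x])
    · rw [lintegral_const]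
      exact ENNReal.mul_ne_top (by finiteness) (measure_ne_top _ _)
    · have h2 : Tendsto (fun j => ‖v j x - u x‖ₑ) atTop (𝓝 0) := by
        rw [← tendsto_iff_enorm_sub_tendsto_zero]
        exact hlim x
      have h3 := (ENNReal.continuous_rpow_const (y := 2)).tendsto (0 : ℝ≥0∞)
      rw [ENNReal.zero_rpow_of_pos (by norm_num)] at h3
      exact h3.comp h2
  simp only [eLpNorm_eq_lintegral_rpow_enorm_toReal (two_ne_zero) (ENNReal.ofNat_ne_top),
    ENNReal.toReal_ofNat, Pi.sub_apply]
  have h3 := (ENNReal.continuous_rpow_const (y := 1 / 2)).tendsto (0 : ℝ≥0∞)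
  rw [ENNReal.zero_rpow_of_pos (by norm_num)] at h3
  exact h3.comp h1

/-- A product function in the coordinates `(x - y, x + y)`. -/
noncomputable def rotProd (f g : ℝ → ℝ) (p : ℝ × ℝ) : ℂ := ((f (p.1 - p.2) * g (p.1 + p.2) : ℝ) : ℂ)

theorem dx_rotProd {f g : ℝ → ℝ} (hf : Differentiable ℝ f) (hg : Differentiable ℝ g) (p : ℝ × ℝ) :
    dx (rotProd f g) p = rotProd (deriv f) g p + rotProd f (deriv g) p ∧
    dy (rotProd f g) p = -rotProd (deriv f) g p + rotProd f (deriv g) p := by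
  have h1 : HasFDerivAt (fun p : ℝ × ℝ => f (p.1 - p.2))
      (deriv f (p.1 - p.2) • (ContinuousLinearMap.fst ℝ ℝ ℝ - ContinuousLinearMap.snd ℝ ℝ ℝ)) p :=
    (hf (p.1 - p.2)).hasDerivAt.comp_hasFDerivAt p (hasFDerivAt_fst.sub hasFDerivAt_snd)
  have h2 : HasFDerivAt (fun p : ℝ × ℝ => g (p.1 + p.2))
      (deriv g (p.1 + p.2) • (ContinuousLinearMap.fst ℝ ℝ ℝ + ContinuousLinearMap.snd ℝ ℝ ℝ)) p :=
    (hg (p.1 + p.2)).hasDerivAt.comp_hasFDerivAt p (hasFDerivAt_fst.add hasFDerivAt_snd)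
  have h3 : HasFDerivAt (rotProd f g) _ p :=
    Complex.ofRealCLM.hasFDerivAt.comp p (h1.mul h2)
  rw [dx, dy, h3.fderiv]
  constructor
  · simp [rotProd]; ring
  · simp [rotProd]; ring

theorem isCore_rotProd {edge : EdgeCondition} {d L : ℝ} {f g : ℝ → ℝ} (hf : ContDiff ℝ ∞ f)
    (hg : ContDiff ℝ ∞ g) (hfs : tsupport f ⊆ Set.Ioo (-d) d)
    (hgs : tsupport g ⊆ Set.Ioo d (2 * L - d)) (hodd : ∀ t, f (-t) = -f t) :
    IsCore (supportBox edge d L) (rotProd f g) := by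
  have hsub : ∀ p ∈ tsupport (rotProd f g), p.1 - p.2 ∈ tsupport f ∧ p.1 + p.2 ∈ tsupport g := by
    have hcl : IsClosed {p : ℝ × ℝ | p.1 - p.2 ∈ tsupport f ∧ p.1 + p.2 ∈ tsupport g} :=
      ((isClosed_tsupport f).preimage (continuous_fst.sub continuous_snd)).inter
        ((isClosed_tsupport g).preimage (continuous_fst.add continuous_snd))
    refine closure_minimal (fun p hp => ?_) hcl
    simp only [Function.mem_support, rotProd, ne_eq, Complex.ofReal_eq_zero, mul_eq_zero,
      not_or] at hp
    exact ⟨subset_tsupport _ hp.1, subset_tsupport _ hp.2⟩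
  refine ⟨?_, ?_, ?_, ?_⟩
  · exact Complex.ofRealCLM.contDiff.comp ((hf.comp (contDiff_fst.sub contDiff_snd)).mul
      (hg.comp (contDiff_fst.add contDiff_snd)))
  · refine HasCompactSupport.of_support_subset_isCompact
      ((isCompact_Icc (a := (0 : ℝ)) (b := L)).prod (isCompact_Icc (a := (0 : ℝ)) (b := L)))
      fun p hp => ?_
    obtain ⟨h1, h2⟩ := hsub p (subset_tsupport _ hp)
    have h1 := hfs h1
    have h2 := hgs h2
    simp only [Set.mem_Ioo] at h1 h2
    exact ⟨⟨by linarith, by linarith⟩, ⟨by linarith, by linarith⟩⟩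
  · intro p hp
    obtain ⟨h1, h2⟩ := hsub p hp
    have h1 := hfs h1
    have h2 := hgs h2
    simp only [Set.mem_Ioo] at h1 h2
    refine ⟨⟨show |p.1 - p.2| < d from abs_lt.2 ⟨by linarith, by linarith⟩, ?_⟩,
      ⟨show p.1 < L by linarith, show p.2 < L by linarith⟩⟩
    cases edge
    · exact ⟨show 0 < p.1 by linarith, show 0 < p.2 by linarith⟩
    · trivial
  · intro x y
    simp only [rotProd]
    rw [← neg_sub y x, hodd, add_comm]
    push_cast
    ring

theorem integrable_indicator_Ioo_of_bound {f : ℝ → ℝ} {a b M : ℝ} (hf : Measurable f)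
    (hs : ∀ t, t ∉ Set.Ioo a b → f t = 0) (hb : ∀ t, |f t| ≤ M) : Integrable f := by
  have h : IntegrableOn f (Set.Ioo a b) :=
    Measure.integrableOn_of_bounded (by simp) hf.aestronglyMeasurable
      (Eventually.of_forall hb)
  exact h.integrable_of_forall_notMem_eq_zero hs

/-- The modes of `x - y` on `(-d, d)` that are odd. -/
noncomputable abbrev relMode (d : ℝ) (n : ℕ) : ℝ → ℝ := mode (-d) d (2 * (n + 1))
/-- The derivative of `relMode`. -/
noncomputable abbrev relModeDeriv (d : ℝ) (n : ℕ) : ℝ → ℝ := modeDeriv (-d) d (2 * (n + 1))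
/-- The modes of `x + y` on `(d, 2L - d)`. -/
noncomputable abbrev comMode (d L : ℝ) (k : ℕ) : ℝ → ℝ := mode d (2 * L - d) (k + 1)
/-- The derivative of `comMode`. -/
noncomputable abbrev comModeDeriv (d L : ℝ) (k : ℕ) : ℝ → ℝ := modeDeriv d (2 * L - d) (k + 1)

/-- The energy of the trial function with relative mode `n` and centre-of-mass mode `k`. -/
noncomputable def trialEnergy (d L : ℝ) (i : ℕ × ℕ) : ℝ :=
  2 * Real.pi ^ 2 * ((i.1 : ℝ) + 1) ^ 2 / d ^ 2 +
    (((i.2 : ℝ) + 1) * (Real.pi / (√2 * (L - d)))) ^ 2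

theorem bounded_modeDeriv (a b : ℝ) (n : ℕ) : ∃ M, ∀ t, |modeDeriv a b n t| ≤ M := by
  refine ⟨|n * (Real.pi / (b - a))|, fun t => ?_⟩
  by_cases ht : t ∈ Set.Ioo a b
  · simp only [modeDeriv, Set.indicator_of_mem ht]
    rw [abs_mul]
    exact mul_le_of_le_one_right (abs_nonneg _) (Real.abs_cos_le_one _)
  · simp only [modeDeriv, Set.indicator_of_notMem ht, abs_zero]
    positivity

theorem integrable_mode_mul (a b : ℝ) (n m : ℕ) :
    Integrable fun t => mode a b n t * mode a b m t := by
  refine integrable_indicator_Ioo_of_bound (a := a) (b := b) (M := 1)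
    ((measurable_mode a b n).mul (measurable_mode a b m))
    (fun t ht => by simp [mode, Set.indicator_of_notMem ht]) fun t => ?_
  rw [abs_mul]
  exact mul_le_one₀ (abs_mode_le n t) (abs_nonneg _) (abs_mode_le m t)

theorem integrable_modeDeriv_mul (a b : ℝ) (n m : ℕ) :
    Integrable fun t => modeDeriv a b n t * modeDeriv a b m t := by
  obtain ⟨M, hM⟩ := bounded_modeDeriv a b n
  obtain ⟨M', hM'⟩ := bounded_modeDeriv a b m
  refine integrable_indicator_Ioo_of_bound (a := a) (b := b) (M := M * M')
    ((measurable_modeDeriv a b n).mul (measurable_modeDeriv a b m))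
    (fun t ht => by simp [modeDeriv, Set.indicator_of_notMem ht]) fun t => ?_
  rw [abs_mul]
  exact mul_le_mul (hM t) (hM' t) (abs_nonneg _) ((abs_nonneg _).trans (hM t))

variable {d L : ℝ}

instance (d L : ℝ) : IsFiniteMeasure (volume.restrict (configBox d L)) := by
  refine isFiniteMeasure_restrict.2 (ne_top_of_le_ne_top ?_
    (measure_mono (configBox_subset d L)))
  exact (isCompact_Icc.prod isCompact_Icc).measure_lt_top.ne

/-- The trial functions and their gradients lie in the closed graph. -/
theorem exists_trial (edge : EdgeCondition) (hd : 0 < d) (hL : d < L) (i : ℕ × ℕ) :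
    ∃ z ∈ formGraph (configBox d L) (supportBox edge d L),
      z 0 =ᵐ[volume.restrict (configBox d L)] rotProd (relMode d i.1) (comMode d L i.2) ∧
      z 1 =ᵐ[volume.restrict (configBox d L)] (rotProd (relModeDeriv d i.1) (comMode d L i.2) +
        rotProd (relMode d i.1) (comModeDeriv d L i.2)) ∧
      z 2 =ᵐ[volume.restrict (configBox d L)] (-rotProd (relModeDeriv d i.1) (comMode d L i.2) +
        rotProd (relMode d i.1) (comModeDeriv d L i.2)) := by
  obtain ⟨n, k⟩ := i
  have hd' : -d < d := by linarith
  have hL' : d < 2 * L - d := by linarith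
  set F : ℕ → ℝ → ℝ := fun j => cutMode (-d) d (2 * (n + 1)) j with hF
  set G : ℕ → ℝ → ℝ := fun j => cutMode d (2 * L - d) (k + 1) j with hG
  have hFc : ∀ j, ContDiff ℝ ∞ (F j) := fun j => contDiff_cutMode _ j
  have hGc : ∀ j, ContDiff ℝ ∞ (G j) := fun j => contDiff_cutMode _ j
  have hcore : ∀ j, IsCore (supportBox edge d L) (rotProd (F j) (G j)) := fun j =>
    isCore_rotProd (hFc j) (hGc j) (tsupport_cutMode _ j) (tsupport_cutMode _ j)
      (fun t => cutMode_neg hd (n + 1) j t)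
  obtain ⟨M, hM⟩ := exists_bound_deriv_cutMode hd' (2 * (n + 1))
  obtain ⟨M', hM'⟩ := exists_bound_deriv_cutMode hL' (k + 1)
  have hM0 : 0 ≤ M := (abs_nonneg _).trans (hM 0 0)
  have hdx : ∀ j, dx (rotProd (F j) (G j)) =
      rotProd (deriv (F j)) (G j) + rotProd (F j) (deriv (G j)) := fun j => by
    ext p; exact (dx_rotProd ((hFc j).differentiable (by simp))
      ((hGc j).differentiable (by simp)) p).1
  have hdy : ∀ j, dy (rotProd (F j) (G j)) =
      -rotProd (deriv (F j)) (G j) + rotProd (F j) (deriv (G j)) := fun j => by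
    ext p; exact (dx_rotProd ((hFc j).differentiable (by simp))
      ((hGc j).differentiable (by simp)) p).2
  have b1 : ∀ j p, ‖rotProd (deriv (F j)) (G j) p‖ ≤ M := fun j p => by
    rw [rotProd, Complex.norm_real, Real.norm_eq_abs, abs_mul, ← mul_one M]
    exact mul_le_mul (hM j _) (abs_cutMode_le _ j _) (abs_nonneg _) hM0
  have b2 : ∀ j p, ‖rotProd (F j) (deriv (G j)) p‖ ≤ M' := fun j p => by
    rw [rotProd, Complex.norm_real, Real.norm_eq_abs, abs_mul, ← one_mul M']
    exact mul_le_mul (abs_cutMode_le _ j _) (hM' j _) (abs_nonneg _) zero_le_one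
  have l0 : ∀ p, Tendsto (fun j => rotProd (F j) (G j) p) atTop
      (𝓝 (rotProd (relMode d n) (comMode d L k) p)) := fun p =>
    (Complex.continuous_ofReal.tendsto _).comp
      ((tendsto_cutMode hd' _ _).mul (tendsto_cutMode hL' _ _))
  have l1 : ∀ p, Tendsto (fun j => rotProd (deriv (F j)) (G j) p) atTop
      (𝓝 (rotProd (relModeDeriv d n) (comMode d L k) p)) := fun p =>
    (Complex.continuous_ofReal.tendsto _).comp
      ((tendsto_deriv_cutMode hd' _ _).mul (tendsto_cutMode hL' _ _))
  have l2 : ∀ p, Tendsto (fun j => rotProd (F j) (deriv (G j)) p) atTop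
      (𝓝 (rotProd (relMode d n) (comModeDeriv d L k) p)) := fun p =>
    (Complex.continuous_ofReal.tendsto _).comp
      ((tendsto_cutMode hd' _ _).mul (tendsto_deriv_cutMode hL' _ _))
  obtain ⟨m0, t0⟩ := tendsto_eLpNorm_of_bounded (ν := volume.restrict (configBox d L)) (M := 1)
    (fun j => (hcore j).1.continuous.measurable) (fun j p => by
      rw [rotProd, Complex.norm_real, Real.norm_eq_abs, abs_mul]
      exact mul_le_one₀ (abs_cutMode_le _ j _) (abs_nonneg _) (abs_cutMode_le _ j _)) l0
  obtain ⟨m1, t1⟩ := tendsto_eLpNorm_of_bounded (ν := volume.restrict (configBox d L))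
    (M := M + M') (v := fun j => dx (rotProd (F j) (G j)))
    (u := rotProd (relModeDeriv d n) (comMode d L k) + rotProd (relMode d n) (comModeDeriv d L k))
    (fun j => (hcore j).continuous_dx.measurable) (fun j p => by
      rw [hdx]; exact (norm_add_le _ _).trans (add_le_add (b1 j p) (b2 j p)))
    (fun p => by simp only [hdx]; exact (l1 p).add (l2 p))
  obtain ⟨m2, t2⟩ := tendsto_eLpNorm_of_bounded (ν := volume.restrict (configBox d L))
    (M := M + M') (v := fun j => dy (rotProd (F j) (G j)))
    (u := -rotProd (relModeDeriv d n) (comMode d L k) + rotProd (relMode d n) (comModeDeriv d L k))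
    (fun j => (hcore j).continuous_dy.measurable) (fun j p => by
      rw [hdy]
      refine (norm_add_le _ _).trans (add_le_add ?_ (b2 j p))
      rw [Pi.neg_apply, norm_neg]
      exact b1 j p)
    (fun p => by simp only [hdy]; exact (l1 p).neg.add (l2 p))
  refine ⟨WithLp.toLp 2 ![m0.toLp _, m1.toLp _, m2.toLp _], ?_, m0.coeFn_toLp, m1.coeFn_toLp,
    m2.coeFn_toLp⟩
  rw [← hasFormGradient_iff]
  refine ⟨fun j => rotProd (F j) (G j), hcore, ?_, ?_, ?_⟩
  · refine t0.congr fun j => eLpNorm_congr_ae ?_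
    filter_upwards [m0.coeFn_toLp] with p hp
    exact congrArg (rotProd (F j) (G j) p - ·) hp.symm
  · refine t1.congr fun j => eLpNorm_congr_ae ?_
    filter_upwards [m1.coeFn_toLp] with p hp
    exact congrArg (dx (rotProd (F j) (G j)) p - ·) hp.symm
  · refine t2.congr fun j => eLpNorm_congr_ae ?_
    filter_upwards [m2.coeFn_toLp] with p hp
    exact congrArg (dy (rotProd (F j) (G j)) p - ·) hp.symm

/-- Outside `Ω_L` the product of a relative and a centre-of-mass mode vanishes. -/
theorem mode_mul_mode_eq_zero {f g : ℝ → ℝ} (hf : ∀ t, t ∉ Set.Ioo (-d) d → f t = 0)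
    (hg : ∀ s, s ∉ Set.Ioo d (2 * L - d) → g s = 0) {p : ℝ × ℝ} (hp : p ∉ configBox d L) :
    f (p.1 - p.2) * g (p.1 + p.2) = 0 := by
  by_contra h
  rw [mul_eq_zero, not_or] at h
  have h1 : p.1 - p.2 ∈ Set.Ioo (-d) d := by_contra fun h' => h.1 (hf _ h')
  have h2 : p.1 + p.2 ∈ Set.Ioo d (2 * L - d) := by_contra fun h' => h.2 (hg _ h')
  simp only [Set.mem_Ioo] at h1 h2
  exact hp ⟨⟨by linarith, by linarith, abs_le.2 ⟨by linarith, by linarith⟩⟩, by linarith,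
    by linarith⟩

/-- The min-max upper bound: distinct trial functions of energy at most `E` yield as many
orthonormal eigenvectors with eigenvalue at most `E`. -/
theorem exists_eigenvectors_box (edge : EdgeCondition) (hd : 0 < d) (hL : d < L) {m : ℕ}
    {σ : Fin m → ℕ × ℕ} (hσ : Function.Injective σ) {E : ℝ} (hE0 : 0 ≤ E)
    (hE : ∀ i, trialEnergy d L (σ i) ≤ E) :
    ∃ f : Fin m → Lp ℂ 2 (volume.restrict (configBox d L)), Orthonormal ℂ f ∧
      ∀ i, ∃ e ≤ E, IsEigenvector (configBox d L) (supportBox edge d L) e (f i) := by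
  have hd' : -d < d := by linarith
  have hL' : d < 2 * L - d := by linarith
  choose z hz z0 z1 z2 using fun i : Fin m => exists_trial edge hd hL (σ i)
  have hLd : 0 < L - d := by linarith
  refine exists_eigenvectors_of_trial (isCompactOperator_formEmbedding edge d (hd.trans hL)) hz
    (a := d * (L - d) / 2) (e := fun i => trialEnergy d L (σ i)) (by positivity) ?_ ?_ hE0 hE
  · intro i j
    rw [L2.inner_def]
    have hae : (fun p => inner ℂ (z i 0 p) (z j 0 p)) =ᵐ[volume.restrict (configBox d L)]
        fun p => (((relMode d (σ i).1 (p.1 - p.2) * relMode d (σ j).1 (p.1 - p.2)) *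
          (comMode d L (σ i).2 (p.1 + p.2) * comMode d L (σ j).2 (p.1 + p.2)) : ℝ) : ℂ) := by
      filter_upwards [z0 i, z0 j] with p hi hj
      rw [hi, hj, RCLike.inner_apply, rotProd, rotProd, Complex.conj_ofReal]
      push_cast
      ring
    rw [integral_congr_ae hae, integral_complex_ofReal,
      setIntegral_eq_integral_of_forall_compl_eq_zero fun p hp =>
        mode_mul_mode_eq_zero (L := L)
          (f := fun t => relMode d (σ i).1 t * relMode d (σ j).1 t)
          (g := fun s => comMode d L (σ i).2 s * comMode d L (σ j).2 s)
          (fun t ht => by simp [mode, Set.indicator_of_notMem ht])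
          (fun t ht => by simp [mode, Set.indicator_of_notMem ht]) hp,
      integral_sub_mul_add (fun t => relMode d (σ i).1 t * relMode d (σ j).1 t)
        (fun s => comMode d L (σ i).2 s * comMode d L (σ j).2 s),
      integral_mode_mul_mode hd' (by omega), integral_mode_mul_mode hL' (by omega)]
    by_cases hij : i = j
    · subst hij
      simp only [if_true]
      congr 1
      ring
    · rw [if_neg hij]
      have hne : ¬ ((σ i).1 = (σ j).1 ∧ (σ i).2 = (σ j).2) := fun h =>
        hij (hσ (Prod.ext h.1 h.2))
      by_cases h1 : (σ i).1 = (σ j).1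
      · rw [if_neg (c := (σ i).2 + 1 = (σ j).2 + 1) (by omega)]; simp
      · rw [if_neg (c := 2 * ((σ i).1 + 1) = 2 * ((σ j).1 + 1)) (by omega)]; simp
  · intro i j
    rw [L2.inner_def, L2.inner_def, ← integral_add (L2.integrable_inner _ _)
      (L2.integrable_inner _ _)]
    have hae : (fun p => inner ℂ (z i 1 p) (z j 1 p) + inner ℂ (z i 2 p) (z j 2 p))
        =ᵐ[volume.restrict (configBox d L)] fun p => ((2 *
          ((relModeDeriv d (σ i).1 (p.1 - p.2) * relModeDeriv d (σ j).1 (p.1 - p.2)) *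
          (comMode d L (σ i).2 (p.1 + p.2) * comMode d L (σ j).2 (p.1 + p.2)) +
          (relMode d (σ i).1 (p.1 - p.2) * relMode d (σ j).1 (p.1 - p.2)) *
          (comModeDeriv d L (σ i).2 (p.1 + p.2) * comModeDeriv d L (σ j).2 (p.1 + p.2))) : ℝ)
          : ℂ) := by
      filter_upwards [z1 i, z1 j, z2 i, z2 j] with p hi hj hi' hj'
      rw [hi, hj, hi', hj']
      simp only [RCLike.inner_apply, rotProd, Pi.add_apply, Pi.neg_apply, map_add, map_neg,
        Complex.conj_ofReal]
      push_cast
      ring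
    rw [integral_congr_ae hae, integral_complex_ofReal, integral_const_mul]
    have i1 := integrable_sub_mul_add (integrable_modeDeriv_mul (-d) d (2 * ((σ i).1 + 1))
      (2 * ((σ j).1 + 1))) (integrable_mode_mul d (2 * L - d) ((σ i).2 + 1) ((σ j).2 + 1))
    have i2 := integrable_sub_mul_add (integrable_mode_mul (-d) d (2 * ((σ i).1 + 1))
      (2 * ((σ j).1 + 1))) (integrable_modeDeriv_mul d (2 * L - d) ((σ i).2 + 1) ((σ j).2 + 1))
    rw [setIntegral_eq_integral_of_forall_compl_eq_zero fun p hp => by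
        rw [mode_mul_mode_eq_zero (L := L)
          (f := fun t => relModeDeriv d (σ i).1 t * relModeDeriv d (σ j).1 t)
          (g := fun s => comMode d L (σ i).2 s * comMode d L (σ j).2 s)
          (fun t ht => by simp [modeDeriv, Set.indicator_of_notMem ht])
          (fun t ht => by simp [mode, Set.indicator_of_notMem ht]) hp,
          mode_mul_mode_eq_zero (L := L)
          (f := fun t => relMode d (σ i).1 t * relMode d (σ j).1 t)
          (g := fun s => comModeDeriv d L (σ i).2 s * comModeDeriv d L (σ j).2 s)
          (fun t ht => by simp [mode, Set.indicator_of_notMem ht])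
          (fun t ht => by simp [modeDeriv, Set.indicator_of_notMem ht]) hp, add_zero],
      integral_add i1 i2,
      integral_sub_mul_add (fun t => relModeDeriv d (σ i).1 t * relModeDeriv d (σ j).1 t)
        (fun s => comMode d L (σ i).2 s * comMode d L (σ j).2 s),
      integral_sub_mul_add (fun t => relMode d (σ i).1 t * relMode d (σ j).1 t)
        (fun s => comModeDeriv d L (σ i).2 s * comModeDeriv d L (σ j).2 s),
      integral_mode_mul_mode hd' (by omega), integral_mode_mul_mode hL' (by omega),
      integral_modeDeriv_mul_modeDeriv hd' (by omega),
      integral_modeDeriv_mul_modeDeriv hL' (by omega)]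
    by_cases hij : i = j
    · subst hij
      simp only [if_true]
      congr 1
      have h2 : (√2) ^ 2 = 2 := Real.sq_sqrt (by norm_num)
      have h3 : 2 * L - d - d = 2 * (L - d) := by ring
      have h4 : d - -d = 2 * d := by ring
      rw [trialEnergy, h3, h4, mul_pow _ (Real.pi / (√2 * (L - d))), div_pow, mul_pow (√2), h2]
      push_cast
      have := hLd.ne'
      field_simp
    · rw [if_neg hij]
      have hne : ¬ ((σ i).1 = (σ j).1 ∧ (σ i).2 = (σ j).2) := fun h =>
        hij (hσ (Prod.ext h.1 h.2))
      by_cases h1 : (σ i).1 = (σ j).1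
      · simp only [if_neg (show ¬ (σ i).2 + 1 = (σ j).2 + 1 by omega)]; simp
      · simp only [if_neg (show ¬ 2 * ((σ i).1 + 1) = 2 * ((σ j).1 + 1) by omega)]; simp

end Trial

/-! ### Pair levels and the bottom of the spectrum -/

section Levels

variable {edge : EdgeCondition} {d L : ℝ}

theorem trialEnergy_pos (hd : 0 < d) (i : ℕ × ℕ) : 0 < trialEnergy d L i := by
  unfold trialEnergy
  have := Real.pi_pos
  positivity

theorem levelSet_nonempty (hd : 0 < d) (hL : d < L) (n : ℕ) :
    {E : ℝ | ∃ f : Fin (n + 1) → Lp ℂ 2 (volume.restrict (configBox d L)), Orthonormal ℂ f ∧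
      ∀ i, ∃ e ≤ E, IsEigenvector (configBox d L) (supportBox edge d L) e (f i)}.Nonempty := by
  let σ : Fin (n + 1) → ℕ × ℕ := fun i => (i, 0)
  have hσ : Function.Injective σ := fun i j h => Fin.ext (congrArg Prod.fst h)
  exact ⟨∑ i, trialEnergy d L (σ i), exists_eigenvectors_box edge hd hL hσ
    (Finset.sum_nonneg fun i _ => (trialEnergy_pos hd _).le)
    fun i => Finset.single_le_sum (f := fun i => trialEnergy d L (σ i))
      (fun i _ => (trialEnergy_pos hd _).le) (Finset.mem_univ i)⟩

theorem bottomEnergy_mem_lowerBounds (n : ℕ) :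
    bottomEnergy edge d ∈ lowerBounds
      {E : ℝ | ∃ f : Fin (n + 1) → Lp ℂ 2 (volume.restrict (configBox d L)), Orthonormal ℂ f ∧
        ∀ i, ∃ e ≤ E, IsEigenvector (configBox d L) (supportBox edge d L) e (f i)} := by
  rintro E ⟨f, hf, hfe⟩
  obtain ⟨e, he, hee⟩ := hfe 0
  exact (bottomEnergy_le_of_isEigenvector hee (hf.1 0)).trans he

theorem bottomEnergy_le_pairLevel (hd : 0 < d) (hL : d < L) (n : ℕ) :
    bottomEnergy edge d ≤ pairLevel edge d L n :=
  le_csInf (levelSet_nonempty hd hL n) (bottomEnergy_mem_lowerBounds n)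

theorem pairLevel_zero_le (hd : 0 < d) (hL : d < L) (n : ℕ) :
    pairLevel edge d L 0 ≤ pairLevel edge d L n := by
  refine csInf_le_csInf ⟨_, bottomEnergy_mem_lowerBounds 0⟩ (levelSet_nonempty hd hL n) ?_
  rintro E ⟨f, hf, hfe⟩
  exact ⟨fun _ => f 0, ⟨fun _ => hf.1 0, fun i j hij =>
    absurd (Fin.ext (by omega)) hij⟩,
    fun _ => hfe 0⟩

/-- The `n`-th level is at most the largest energy of any `n + 1` trial functions. -/
theorem pairLevel_le (hd : 0 < d) (hL : d < L) {n : ℕ} {S : Finset (ℕ × ℕ)} (hS : S.card = n + 1)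
    {E : ℝ} (hE0 : 0 ≤ E) (hE : ∀ i ∈ S, trialEnergy d L i ≤ E) : pairLevel edge d L n ≤ E := by
  let σ : Fin (n + 1) → ℕ × ℕ := fun i => (S.equivFin.symm (Fin.cast hS.symm i) : ℕ × ℕ)
  have hσ : Function.Injective σ := fun i j h => by
    simpa [σ, Subtype.coe_inj] using h
  exact csInf_le ⟨_, bottomEnergy_mem_lowerBounds n⟩
    (exists_eigenvectors_box edge hd hL hσ hE0 fun i => hE _ (Subtype.coe_prop _))

theorem pairLevel_zero_le_trialEnergy (hd : 0 < d) (hL : d < L) (i : ℕ × ℕ) :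
    pairLevel edge d L 0 ≤ trialEnergy d L i :=
  pairLevel_le hd hL (S := {i}) (by simp) (trialEnergy_pos hd i).le (by simp)

/-- The step of the trial momenta tends to zero. -/
theorem tendsto_momentum_step (d : ℝ) :
    Tendsto (fun L => Real.pi / (√2 * (L - d))) atTop (𝓝 0) :=
  tendsto_const_nhds.div_atTop
    ((tendsto_atTop_add_const_right _ (-d) tendsto_id).const_mul_atTop (by positivity))

theorem tendsto_trialEnergy (d : ℝ) (n : ℕ) :
    Tendsto (fun L => trialEnergy d L (n, 0)) atTop
      (𝓝 (2 * Real.pi ^ 2 * ((n : ℝ) + 1) ^ 2 / d ^ 2)) := by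
  have h := (((tendsto_momentum_step d).const_mul (1 : ℝ)).pow 2).const_add
    (2 * Real.pi ^ 2 * ((n : ℝ) + 1) ^ 2 / d ^ 2)
  simpa [trialEnergy] using h

theorem bottomEnergy_le (hd : 0 < d) : bottomEnergy edge d ≤ 2 * Real.pi ^ 2 / d ^ 2 := by
  have h := tendsto_trialEnergy d 0
  norm_num at h
  refine ge_of_tendsto h ?_
  filter_upwards [eventually_gt_atTop d] with L hL
  exact (bottomEnergy_le_pairLevel hd hL 0).trans (pairLevel_zero_le_trialEnergy hd hL (0, 0))

/-- There are normalised core functions on `Ω`. -/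
theorem energies_nonempty (hd : 0 < d) :
    {E : ℝ | ∃ u, IsCore (support edge d) u ∧ ∫ p in config d, ‖u p‖ ^ 2 = 1 ∧
      E = ∫ p in config d, (‖dx u p‖ ^ 2 + ‖dy u p‖ ^ 2)}.Nonempty := by
  obtain ⟨E, f, hf, hfe⟩ := levelSet_nonempty (edge := edge) hd (show d < d + 1 by linarith) 0
  obtain ⟨e, -, he⟩ := hfe 0
  obtain ⟨x, hx, hxf, -⟩ := isEigenvector_iff.1 he
  -- were all core functions null on `Ω`, the closed form would only contain null functions
  obtain ⟨u, hu, hu0⟩ : ∃ u, IsCore (support edge d) u ∧ 0 < ∫ p in config d, ‖u p‖ ^ 2 := by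
    by_contra hcon
    push Not at hcon
    have hcl : IsClosed {y : Triple (configBox d (d + 1)) | ‖y 0‖ ^ 2 ≤ 0} :=
      isClosed_le (by fun_prop) (by fun_prop)
    have hx0 : ‖x 0‖ ^ 2 ≤ 0 := by
      refine closure_minimal ?_ hcl hx
      rintro _ ⟨v, hv, rfl⟩
      refine le_trans (norm_toLp_sq hv.memLp).le
        (le_trans ?_ (hcon v (hv.mono Set.inter_subset_left)))
      exact setIntegral_mono_set (hv.memLp.integrable_norm_pow (by simp))
        (Eventually.of_forall fun p => sq_nonneg _)
        (show configBox d (d + 1) ⊆ config d from fun p hp => hp.1).eventuallyLE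
    rw [hxf, hf.1 0] at hx0
    norm_num at hx0
  obtain ⟨v, hv, hv1, -⟩ := hu.exists_normalized hu0
  exact ⟨_, v, hv, hv1, rfl⟩

theorem bottomEnergy_dirichlet (hd : 0 < d) :
    bottomEnergy .dirichlet d = 2 * Real.pi ^ 2 / d ^ 2 := by
  refine le_antisymm (bottomEnergy_le hd) (le_csInf (energies_nonempty hd) ?_)
  rintro _ ⟨u, hu, hu1, rfl⟩
  have := energy_ge_dirichlet hd hu
  rwa [hu1, mul_one] at this

theorem bottomEnergy_pos (hd : 0 < d) : 0 < bottomEnergy edge d := by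
  cases edge
  · rw [bottomEnergy_dirichlet hd]
    have := Real.pi_pos
    positivity
  · refine lt_of_lt_of_le (show 0 < 1 / (4 * d ^ 2) by positivity)
      (le_csInf (energies_nonempty hd) ?_)
    rintro _ ⟨u, hu, hu1, rfl⟩
    have := energy_ge_neumann hd hu
    rwa [hu1, mul_one] at this

end Levels

/-! ### The thermodynamic limit of the bulk density -/

section Density

variable {edge : EdgeCondition} {d L β : ℝ}

theorem exp_sub_one_pos {x y : ℝ} (hβ : 0 < β) (h : x < y) : 0 < Real.exp (β * (y - x)) - 1 := by
  have : 0 < β * (y - x) := mul_pos hβ (sub_pos.2 h)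
  linarith [Real.one_lt_exp_iff.2 this]

theorem occupation_anti (hβ : 0 < β) {μ E E' : ℝ} (hE : μ < E) (hEE : E ≤ E') :
    occupation β E' μ ≤ occupation β E μ := by
  unfold occupation
  have h1 := exp_sub_one_pos hβ hE
  gcongr

theorem occupation_nonneg (hβ : 0 < β) {μ E : ℝ} (hE : μ < E) : 0 ≤ occupation β E μ :=
  div_nonneg zero_le_one (exp_sub_one_pos hβ hE).le

/-- Any set of trial functions carries at most as many particles as the pair levels: ordered by
energy, the trial energies dominate the levels. -/
theorem sum_occupation_trial_le (hd : 0 < d) (hL : d < L) (hβ : 0 < β) {μ : ℝ}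
    (hμ : μ < pairLevel edge d L 0) (S : Finset (ℕ × ℕ)) :
    ∑ i ∈ S, ENNReal.ofReal (occupation β (trialEnergy d L i) μ) ≤
      ∑ m ∈ Finset.range S.card, ENNReal.ofReal (occupation β (pairLevel edge d L m) μ) := by
  classical
  induction S using Finset.induction_on_max_value (trialEnergy d L) with
  | empty => simp
  | insert a S ha hmax ih =>
    rw [Finset.sum_insert ha, Finset.card_insert_of_notMem ha, Finset.sum_range_succ, add_comm]
    refine add_le_add ih (ENNReal.ofReal_le_ofReal (occupation_anti hβ
      (hμ.trans_le (pairLevel_zero_le hd hL _)) ?_))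
    refine pairLevel_le hd hL (S := insert a S) (Finset.card_insert_of_notMem ha)
      (trialEnergy_pos hd a).le fun i hi => ?_
    rcases Finset.mem_insert.1 hi with rfl | hi
    · exact le_rfl
    · exact hmax i hi

theorem tsum_occupation_trial_le (hd : 0 < d) (hL : d < L) (hβ : 0 < β) {μ : ℝ}
    (hμ : μ < pairLevel edge d L 0) :
    ∑' n, ∑' k, ENNReal.ofReal (occupation β (trialEnergy d L (n, k)) μ) ≤
      ∑' m, ENNReal.ofReal (occupation β (pairLevel edge d L m) μ) := by
  rw [← ENNReal.tsum_prod
    (f := fun n k => ENNReal.ofReal (occupation β (trialEnergy d L (n, k)) μ)),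
    ENNReal.tsum_eq_iSup_sum]
  exact iSup_le fun S => (sum_occupation_trial_le hd hL hβ hμ S).trans (ENNReal.sum_le_tsum _)

/-- A Riemann sum of a function that is antitone on `[h, ∞)` dominates its integral there. -/
theorem setLIntegral_le_mul_tsum {f : ℝ → ℝ≥0∞} {h : ℝ} (hh : 0 < h)
    (hf : AntitoneOn f (Set.Ici h)) :
    ∫⁻ x in Set.Ioi h, f x ≤ ENNReal.ofReal h * ∑' k : ℕ, f (((k : ℝ) + 1) * h) := by
  have hcov : Set.Ioi h ⊆ ⋃ k : ℕ, Set.Ioc (((k : ℝ) + 1) * h) (((k : ℝ) + 1) * h + h) := by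
    intro x hx
    have hx1 : 1 < x / h := (one_lt_div hh).2 hx
    have hc : 1 < ⌈x / h⌉₊ := Nat.lt_ceil.2 (by exact_mod_cast hx1)
    obtain ⟨k, hk⟩ : ∃ k, ⌈x / h⌉₊ = k + 2 := ⟨⌈x / h⌉₊ - 2, by omega⟩
    refine Set.mem_iUnion.2 ⟨k, ?_, ?_⟩
    · have h1 : ((k + 1 : ℕ) : ℝ) < x / h := Nat.lt_ceil.1 (by omega)
      rw [lt_div_iff₀ hh] at h1
      exact_mod_cast h1
    · have h1 : x / h ≤ ((k + 2 : ℕ) : ℝ) := hk ▸ Nat.le_ceil _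
      rw [div_le_iff₀ hh] at h1
      push_cast at h1
      linarith
  calc ∫⁻ x in Set.Ioi h, f x
      ≤ ∫⁻ x in ⋃ k : ℕ, Set.Ioc (((k : ℝ) + 1) * h) (((k : ℝ) + 1) * h + h), f x :=
        lintegral_mono_set hcov
    _ ≤ ∑' k : ℕ, ∫⁻ x in Set.Ioc (((k : ℝ) + 1) * h) (((k : ℝ) + 1) * h + h), f x :=
        lintegral_iUnion_le _ _
    _ ≤ ∑' k : ℕ, ENNReal.ofReal h * f (((k : ℝ) + 1) * h) := by
        refine ENNReal.tsum_le_tsum fun k => ?_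
        have hk : h ≤ ((k : ℝ) + 1) * h := by
          have : 0 ≤ (k : ℝ) * h := by positivity
          linarith
        refine (setLIntegral_mono' (g := fun _ => f (((k : ℝ) + 1) * h)) measurableSet_Ioc
          fun x hx => hf hk (hk.trans hx.1.le) hx.1.le).trans ?_
        rw [setLIntegral_const, Real.volume_Ioc, add_sub_cancel_left, mul_comm]
    _ = _ := ENNReal.tsum_mul_left

/-- The integrand of `excitedDensity`. -/
noncomputable def thermalDensity (β d μ : ℝ) (n : ℕ) (x : ℝ) : ℝ :=
  1 / (Real.exp (β * (2 * Real.pi ^ 2 * ((n : ℝ) + 1) ^ 2 / d ^ 2)) *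
    Real.exp (β * (x ^ 2 - μ)) - 1)

theorem thermalDensity_eq (β d μ : ℝ) (n : ℕ) (x : ℝ) : thermalDensity β d μ n x =
    occupation β (2 * Real.pi ^ 2 * ((n : ℝ) + 1) ^ 2 / d ^ 2 + x ^ 2) μ := by
  rw [thermalDensity, occupation, ← Real.exp_add]
  congr 4
  ring

theorem occupation_trialEnergy (β d L μ : ℝ) (n k : ℕ) :
    occupation β (trialEnergy d L (n, k)) μ =
      thermalDensity β d μ n (((k : ℝ) + 1) * (Real.pi / (√2 * (L - d)))) := by
  rw [thermalDensity_eq, trialEnergy]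

/-- The bulk density at finite length dominates an integral that approximates the density of the
excited states. -/
theorem lintegral_le_bulk (hd : 0 < d) (hL : d < L) (hβ : 0 < β) {μ : ℝ}
    (hμ : μ < pairLevel edge d L 0) :
    ∑' n, ∫⁻ x in Set.Ioi (Real.pi / (√2 * (L - d))), ENNReal.ofReal
        (√2 * (L - d) / (Real.pi * L) * thermalDensity β d μ n x) ≤
      (∑' m, ENNReal.ofReal (occupation β (pairLevel edge d L m) μ)) / ENNReal.ofReal L := by
  have hL0 : 0 < L := hd.trans hL
  have hLd : 0 < L - d := sub_pos.2 hL
  have hpi := Real.pi_pos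
  set h := Real.pi / (√2 * (L - d)) with hh
  have hh0 : 0 < h := by positivity
  set A := √2 * (L - d) / (Real.pi * L) with hA
  have hA0 : 0 ≤ A := by positivity
  have hAh : A * h = L⁻¹ := by rw [hA, hh]; field_simp
  have hpos : ∀ n : ℕ, μ < 2 * Real.pi ^ 2 * ((n : ℝ) + 1) ^ 2 / d ^ 2 + h ^ 2 := fun n => by
    have := hμ.trans_le (pairLevel_zero_le_trialEnergy hd hL (n, 0))
    simpa [trialEnergy, ← hh] using this
  have hstep : ∀ n : ℕ, ∫⁻ x in Set.Ioi h, ENNReal.ofReal (A * thermalDensity β d μ n x) ≤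
      (∑' k : ℕ, ENNReal.ofReal (occupation β (trialEnergy d L (n, k)) μ)) / ENNReal.ofReal L := by
    intro n
    have hanti : AntitoneOn (fun x => ENNReal.ofReal (A * thermalDensity β d μ n x))
        (Set.Ici h) := by
      intro x hx y hy hxy
      have hx : h ≤ x := hx
      refine ENNReal.ofReal_le_ofReal (mul_le_mul_of_nonneg_left ?_ hA0)
      rw [thermalDensity_eq, thermalDensity_eq]
      refine occupation_anti hβ ((hpos n).trans_le ?_) ?_ <;> gcongr
      exact hh0.le.trans hx
    refine (setLIntegral_le_mul_tsum hh0 hanti).trans (le_of_eq ?_)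
    rw [div_eq_mul_inv, mul_comm _ (ENNReal.ofReal L)⁻¹, ← ENNReal.tsum_mul_left,
      ← ENNReal.tsum_mul_left]
    refine tsum_congr fun k => ?_
    rw [occupation_trialEnergy, ENNReal.ofReal_mul hA0, ← mul_assoc, ← ENNReal.ofReal_mul hh0.le,
      mul_comm h A, hAh, ENNReal.ofReal_inv_of_pos hL0]
  calc _ ≤ ∑' n : ℕ, (∑' k : ℕ, ENNReal.ofReal (occupation β (trialEnergy d L (n, k)) μ)) /
        ENNReal.ofReal L := ENNReal.tsum_le_tsum hstep
    _ = (∑' n : ℕ, ∑' k : ℕ, ENNReal.ofReal (occupation β (trialEnergy d L (n, k)) μ)) /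
        ENNReal.ofReal L := by simp only [div_eq_mul_inv, ENNReal.tsum_mul_right]
    _ ≤ _ := ENNReal.div_le_div_right (tsum_occupation_trial_le hd hL hβ hμ) _

/-- In the thermodynamic limit the bulk density is at least the density of the excited states. -/
theorem excitedDensity_le_liminf (hd : 0 < d) (hβ : 0 < β) {L μ : ℕ → ℝ}
    (hL : Tendsto L atTop atTop) {m : ℝ} (hμ : Tendsto μ atTop (𝓝 m))
    (hμL : ∀ k, μ k < pairLevel edge d (L k) 0) :
    excitedDensity β d (m : EReal) ≤ liminf (fun k =>
      (∑' j, ENNReal.ofReal (occupation β (pairLevel edge d (L k) j) (μ k))) /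
        ENNReal.ofReal (L k)) atTop := by
  have hpi := Real.pi_pos
  have hLd : ∀ᶠ k in atTop, d < L k := hL.eventually_gt_atTop d
  have hh : Tendsto (fun k => Real.pi / (√2 * (L k - d))) atTop (𝓝 0) :=
    (tendsto_momentum_step d).comp hL
  have hA : Tendsto (fun k => √2 * (L k - d) / (Real.pi * L k)) atTop (𝓝 (√2 / Real.pi)) := by
    have h1 : Tendsto (fun k => √2 / Real.pi * (1 - d / L k)) atTop
        (𝓝 (√2 / Real.pi * (1 - 0))) :=
      ((tendsto_const_nhds.div_atTop hL).const_sub 1).const_mul _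
    rw [sub_zero, mul_one] at h1
    refine h1.congr' ?_
    filter_upwards [hL.eventually_gt_atTop 0] with k hk
    field_simp
  -- hence no integrand has a singularity inside `(0, ∞)`
  have hm : m ≤ 2 * Real.pi ^ 2 * ((0 : ℕ) + 1 : ℝ) ^ 2 / d ^ 2 := by
    refine le_of_tendsto_of_tendsto hμ ((tendsto_trialEnergy d 0).comp hL) ?_
    filter_upwards [hLd] with k hk
    exact (hμL k).le.trans (pairLevel_zero_le_trialEnergy hd hk (0, 0))
  -- the integrand at finite length, cut off below the momentum step
  set F : ℕ → ℕ → ℝ → ℝ≥0∞ := fun k n => (Set.Ioi (Real.pi / (√2 * (L k - d)))).indicator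
    fun x => ENNReal.ofReal (√2 * (L k - d) / (Real.pi * L k) * thermalDensity β d (μ k) n x)
    with hF
  have hFm : ∀ k n, Measurable (F k n) := fun k n => by
    refine Measurable.indicator ?_ measurableSet_Ioi
    unfold thermalDensity
    fun_prop
  have hlim : ∀ n, ∀ x ∈ Set.Ioi (0 : ℝ), Tendsto (fun k => F k n x) atTop
      (𝓝 (ENNReal.ofReal (√2 / Real.pi * thermalDensity β d m n x))) := by
    intro n x hx
    have hx0 : 0 < x := hx
    have h1 : Tendsto (fun k => √2 * (L k - d) / (Real.pi * L k) * thermalDensity β d (μ k) n x)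
        atTop (𝓝 (√2 / Real.pi * thermalDensity β d m n x)) := by
      refine hA.mul ?_
      simp only [thermalDensity_eq, occupation]
      refine Tendsto.div tendsto_const_nhds ?_ ?_
      · exact ((Real.continuous_exp.tendsto _).comp ((hμ.const_sub _).const_mul β)).sub_const 1
      · refine (exp_sub_one_pos hβ (lt_of_le_of_lt hm ?_)).ne'
        have : (1 : ℝ) ≤ (n : ℝ) + 1 := by linarith [Nat.cast_nonneg (α := ℝ) n]
        have h2 : 2 * Real.pi ^ 2 * ((0 : ℕ) + 1 : ℝ) ^ 2 / d ^ 2 ≤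
            2 * Real.pi ^ 2 * ((n : ℝ) + 1) ^ 2 / d ^ 2 := by
          gcongr
          simp
        have h3 : 0 < x ^ 2 := by positivity
        linarith
    refine ((ENNReal.continuous_ofReal.tendsto _).comp h1).congr' ?_
    filter_upwards [hh.eventually_lt_const hx0] with k hk
    simp only [hF, Function.comp_apply, Set.indicator_of_mem (Set.mem_Ioi.2 hk)]
  have hexc : excitedDensity β d (m : EReal) = ∑' n, ∫⁻ x in Set.Ioi (0 : ℝ),
      ENNReal.ofReal (√2 / Real.pi * thermalDensity β d m n x) := by
    rw [excitedDensity, if_neg (EReal.coe_ne_bot m), ← ENNReal.tsum_mul_left]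
    refine tsum_congr fun n => ?_
    rw [← lintegral_const_mul' _ _ ENNReal.ofReal_ne_top]
    refine lintegral_congr fun x => ?_
    rw [ENNReal.ofReal_mul (by positivity), EReal.toReal_coe, thermalDensity]
  rw [hexc]
  calc ∑' n, ∫⁻ x in Set.Ioi (0 : ℝ), ENNReal.ofReal (√2 / Real.pi * thermalDensity β d m n x)
      ≤ ∑' n, liminf (fun k => ∫⁻ x in Set.Ioi (0 : ℝ), F k n x) atTop := by
        refine ENNReal.tsum_le_tsum fun n => ?_
        refine le_trans (le_of_eq ?_) (lintegral_liminf_le fun k => hFm k n)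
        exact setLIntegral_congr_fun measurableSet_Ioi fun x hx => (hlim n x hx).liminf_eq.symm
    _ ≤ liminf (fun k => ∑' n, ∫⁻ x in Set.Ioi (0 : ℝ), F k n x) atTop := by
        simp only [← lintegral_count]
        exact lintegral_liminf_le fun k => measurable_of_countable _
    _ ≤ _ := by
        refine liminf_le_liminf ?_
        filter_upwards [hLd] with k hk
        refine le_trans (ENNReal.tsum_le_tsum fun n => ?_) (lintegral_le_bulk hd hk hβ (hμL k))
        exact (setLIntegral_le_lintegral _ _).trans (lintegral_indicator measurableSet_Ioi _).le

end Density

/-! ### The surface density -/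

section Surface

theorem ofReal_sum_le {ι : Type*} (s : Finset ι) (f : ι → ℝ) :
    ENNReal.ofReal (∑ i ∈ s, f i) ≤ ∑ i ∈ s, ENNReal.ofReal (f i) :=
  Finset.le_sum_of_subadditive _ ENNReal.ofReal_zero.le (fun _ _ => ENNReal.ofReal_add_le) s f

variable {edge : EdgeCondition} {d β α lam : ℝ} {e : ℕ → ℝ}

/-- The pairs on the surface and in the bulk together make up the total density. -/
theorem surface_add_bulk_le {L μ ρs : ℝ} {n : ℕ} (hL : 0 < L) (hn : 0 < n)
    (hρs : ρs = 1 / (n : ℝ) * ∑ j : Fin n, occupation β (meanFieldLevel e n α lam ρs j) μ) :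
    ENNReal.ofReal (n * ρs / L) + (∑' m, ENNReal.ofReal (occupation β (pairLevel edge d L m) μ)) /
      ENNReal.ofReal L ≤ totalDensity edge d e β α lam L n μ ρs := by
  have hn0 : (n : ℝ) ≠ 0 := by exact_mod_cast hn.ne'
  have hsum : (n : ℝ) * ρs = ∑ j : Fin n, occupation β (meanFieldLevel e n α lam ρs j) μ := by
    conv_lhs => rw [hρs]
    field_simp
  rw [totalDensity, ENNReal.add_div, hsum, ENNReal.ofReal_div_of_pos hL]
  gcongr
  exact ofReal_sum_le _ _

/-- The self-consistency condition and the density constraint leave at most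
`δ (ρ - r)` for the limiting surface density when the bulk carries at least the density `r`. -/
theorem eventually_surfaceDensity_lt {L μ ρs : ℕ → ℝ} {N : ℝ → ℕ} {ρ δ r C : ℝ}
    (hL_pos : ∀ k, 0 < L k) (hN_pos : ∀ k, 0 < N (L k))
    (hδ : Tendsto (fun k => L k / (N (L k) : ℝ)) atTop (𝓝 δ)) (hρ : 0 < ρ)
    (hρs : ∀ k, ρs k = 1 / (N (L k) : ℝ) * ∑ j : Fin (N (L k)),
      occupation β (meanFieldLevel e (N (L k)) α lam (ρs k) j) (μ k))
    (hdensity : Tendsto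
      (fun k => totalDensity edge d e β α lam (L k) (N (L k)) (μ k) (ρs k))
      atTop (𝓝 (ENNReal.ofReal ρ)))
    (hbulk : ENNReal.ofReal r ≤ liminf (fun k =>
      (∑' m, ENNReal.ofReal (occupation β (pairLevel edge d (L k) m) (μ k))) /
        ENNReal.ofReal (L k)) atTop)
    (hC : δ * (ρ - r) < C) : ∀ᶠ k in atTop, ρs k < C := by
  obtain ⟨η, hη0, hηC⟩ : ∃ η > 0, δ * (ρ - r + 2 * η) < C := by
    have hcont : Tendsto (fun η : ℝ => δ * (ρ - r + 2 * η)) (𝓝[>] 0)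
        (𝓝 (δ * (ρ - r + 2 * 0))) :=
      Tendsto.mono_left (Continuous.tendsto (by fun_prop) _) nhdsWithin_le_nhds
    rw [mul_zero, add_zero] at hcont
    obtain ⟨η, hη⟩ := ((hcont.eventually_lt_const hC).and self_mem_nhdsWithin).exists
    exact ⟨η, hη.2, hη.1⟩
  have h1 : ∀ᶠ k in atTop, ENNReal.ofReal (r - η) ≤
      (∑' m, ENNReal.ofReal (occupation β (pairLevel edge d (L k) m) (μ k))) /
        ENNReal.ofReal (L k) := by
    by_cases h : r - η < 0
    · simp [ENNReal.ofReal_of_nonpos h.le]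
    · have hlt : ENNReal.ofReal (r - η) < ENNReal.ofReal r :=
        (ENNReal.ofReal_lt_ofReal_iff (by linarith)).2 (by linarith)
      filter_upwards [eventually_lt_of_lt_liminf (hlt.trans_le hbulk)] with k hk using hk.le
  have h2 : ∀ᶠ k in atTop, totalDensity edge d e β α lam (L k) (N (L k)) (μ k) (ρs k) <
      ENNReal.ofReal (ρ + η) :=
    hdensity.eventually_lt_const ((ENNReal.ofReal_lt_ofReal_iff (by linarith)).2 (by linarith))
  filter_upwards [h1, h2, (hδ.mul_const (ρ - r + 2 * η)).eventually_lt_const hηC] with k hk1 hk2 hk3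
  have hL := hL_pos k
  have hN : (0 : ℝ) < N (L k) := by exact_mod_cast hN_pos k
  have h3 : ENNReal.ofReal (N (L k) * ρs k / L k + (r - η)) < ENNReal.ofReal (ρ + η) :=
    calc _ ≤ ENNReal.ofReal (N (L k) * ρs k / L k) + ENNReal.ofReal (r - η) :=
          ENNReal.ofReal_add_le
      _ ≤ _ := add_le_add_right hk1 _
      _ ≤ _ := surface_add_bulk_le hL (hN_pos k) (hρs k)
      _ < _ := hk2
  have h4 : N (L k) * ρs k / L k + (r - η) < ρ + η :=
    (ENNReal.ofReal_lt_ofReal_iff (by linarith)).1 h3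
  have h5 : N (L k) * ρs k / L k < ρ - r + 2 * η := by linarith
  rw [div_lt_iff₀ hL] at h5
  refine lt_trans ?_ hk3
  rw [div_mul_eq_mul_div, lt_div_iff₀ hN]
  linarith

end Surface

end PairModel

theorem mainTheorem4
    (edge : PairModel.EdgeCondition)
    (d β α lam ρ δ ν : ℝ) (hd : 0 < d) (hβ : 0 < β) (hα : 0 ≤ α) (hlam : 0 < lam) (hρ : 0 < ρ)
    (hν : 1 < ν)
    -- the edge weights of the path graph and the number of defects up to length `L`
    (e : ℕ → ℝ) (he : ∀ i, 0 ≤ e i) (N : ℝ → ℕ)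
    -- wire lengths, chemical potentials and surface densities along the thermodynamic limit
    (L : ℕ → ℝ) (hL_pos : ∀ k, 0 < L k) (hL : Tendsto L atTop atTop)
    (hN_pos : ∀ k, 0 < N (L k))
    (hδ : Tendsto (fun k => L k / (N (L k) : ℝ)) atTop (𝓝 δ))
    (μ ρs : ℕ → ℝ)
    (hμ_lt : ∀ k, μ k < min (lam * ρs k - α) (PairModel.pairLevel edge d (L k) 0))
    (hρs : ∀ k, ρs k = 1 / (N (L k) : ℝ) * ∑ j : Fin (N (L k)),
      PairModel.occupation β (PairModel.meanFieldLevel e (N (L k)) α lam (ρs k) j) (μ k))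
    (hdensity : Tendsto
      (fun k => PairModel.totalDensity edge d e β α lam (L k) (N (L k)) (μ k) (ρs k))
      atTop (𝓝 (ENNReal.ofReal ρ)))
    (μlim : EReal) (hμ : Tendsto (fun k => (μ k : EReal)) atTop (𝓝 μlim))
    -- the condition on the interaction strength
    (hcond : (δ : EReal) * ((ρ : EReal) - (PairModel.excitedDensity β d μlim : EReal)) <
      (((PairModel.bottomEnergy edge d + α) / (ν * lam) : ℝ) : EReal)) :
    (edge = PairModel.EdgeCondition.dirichlet →
      PairModel.bottomEnergy edge d = 2 * Real.pi ^ 2 / d ^ 2) ∧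
    (∃ ε : ℝ, 0 < ε ∧ μlim < ((PairModel.bottomEnergy edge d - ε : ℝ) : EReal)) ∧
    ∀ n : ℕ, Tendsto
      (fun k => 1 / L k * PairModel.occupation β (PairModel.pairLevel edge d (L k) n) (μ k))
      atTop (𝓝 0) := by
  have hE0 := PairModel.bottomEnergy_pos (edge := edge) hd
  have hd2 : ∀ᶠ k in atTop, d < L k := hL.eventually_gt_atTop d
  have hμ_lt' : ∀ k, μ k < PairModel.pairLevel edge d (L k) 0 :=
    fun k => (hμ_lt k).trans_le (min_le_right _ _)
  have hgap : ∃ ε : ℝ, 0 < ε ∧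
      μlim < ((PairModel.bottomEnergy edge d - ε : ℝ) : EReal) := by
    induction μlim with
    | bot => exact ⟨1, one_pos, EReal.bot_lt_coe _⟩
    | top =>
      -- the chemical potentials are bounded by the energy of the first trial function
      exfalso
      have h1 := (PairModel.tendsto_trialEnergy d 0).comp hL
      obtain ⟨b, hb⟩ := h1.bddAbove_range
      have h2 : (⊤ : EReal) ≤ (b : EReal) := by
        refine le_of_tendsto hμ ?_
        filter_upwards [hd2] with k hk
        exact_mod_cast ((hμ_lt' k).le.trans
          (PairModel.pairLevel_zero_le_trialEnergy hd hk (0, 0))).trans (hb ⟨k, rfl⟩)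
      exact absurd h2 (not_le.2 (EReal.coe_lt_top b))
    | coe m =>
      have hμm : Tendsto μ atTop (𝓝 m) := EReal.tendsto_coe.1 hμ
      have hliminf := PairModel.excitedDensity_le_liminf hd hβ hL hμm hμ_lt'
      have hfin : PairModel.excitedDensity β d (m : EReal) ≤ ENNReal.ofReal ρ := by
        refine hliminf.trans ?_
        rw [← hdensity.liminf_eq]
        refine liminf_le_liminf (Eventually.of_forall fun k => ?_)
        exact le_trans le_add_self
          (PairModel.surface_add_bulk_le (hL_pos k) (hN_pos k) (hρs k))
      -- the constraint on the total density keeps the density of the excited states finite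
      obtain ⟨r, hr0, hr⟩ : ∃ r : ℝ, 0 ≤ r ∧
          PairModel.excitedDensity β d (m : EReal) = ENNReal.ofReal r :=
        ⟨_, ENNReal.toReal_nonneg,
          (ENNReal.ofReal_toReal (ne_top_of_le_ne_top ENNReal.ofReal_ne_top hfin)).symm⟩
      rw [hr, EReal.coe_ennreal_ofReal, max_eq_left hr0] at hcond
      have hcond' : δ * (ρ - r) < (PairModel.bottomEnergy edge d + α) / (ν * lam) := by
        exact_mod_cast hcond
      rw [hr] at hliminf
      have hsurf := PairModel.eventually_surfaceDensity_lt hL_pos hN_pos hδ hρ hρs hdensity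
        hliminf hcond'
      have hm : m ≤ (PairModel.bottomEnergy edge d + α) / ν - α := by
        refine le_of_tendsto hμm ?_
        filter_upwards [hsurf] with k hk
        have h1 : μ k < lam * ρs k - α := (hμ_lt k).trans_le (min_le_left _ _)
        have h2 : lam * ρs k < lam * ((PairModel.bottomEnergy edge d + α) / (ν * lam)) :=
          mul_lt_mul_of_pos_left hk hlam
        have h3 : lam * ((PairModel.bottomEnergy edge d + α) / (ν * lam)) =
            (PairModel.bottomEnergy edge d + α) / ν := by field_simp
        linarith
      have hν0 : 0 < ν := by linarith
      have hstrict : (PairModel.bottomEnergy edge d + α) / ν < PairModel.bottomEnergy edge d + α :=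
        div_lt_self (by linarith) hν
      refine ⟨(PairModel.bottomEnergy edge d + α - (PairModel.bottomEnergy edge d + α) / ν) / 2,
        by linarith, ?_⟩
      exact_mod_cast (by linarith : m < PairModel.bottomEnergy edge d -
        (PairModel.bottomEnergy edge d + α - (PairModel.bottomEnergy edge d + α) / ν) / 2)
  refine ⟨fun h => h ▸ PairModel.bottomEnergy_dirichlet hd, hgap, fun n => ?_⟩
  obtain ⟨ε, hε, hlt⟩ := hgap
  have hinv : Tendsto (fun k => 1 / L k * (1 / (Real.exp (β * ε) - 1))) atTop (𝓝 0) := by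
    have := (tendsto_const_nhds (x := (1 : ℝ)).div_atTop hL).mul_const (1 / (Real.exp (β * ε) - 1))
    rwa [zero_mul] at this
  refine squeeze_zero' ?_ ?_ hinv
  · filter_upwards [hd2] with k hk
    have hk0 := hL_pos k
    have := PairModel.occupation_nonneg hβ
      ((hμ_lt' k).trans_le (PairModel.pairLevel_zero_le (edge := edge) hd hk n))
    positivity
  · filter_upwards [hd2, hμ.eventually_lt_const hlt] with k hk hμk
    have hk0 := hL_pos k
    have hμk' : μ k < PairModel.bottomEnergy edge d - ε := by exact_mod_cast hμk
    have h1 := PairModel.bottomEnergy_le_pairLevel (edge := edge) hd hk n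
    have h2 : PairModel.occupation β (PairModel.pairLevel edge d (L k) n) (μ k) ≤
        PairModel.occupation β (μ k + ε) (μ k) :=
      PairModel.occupation_anti hβ (by linarith) (by linarith)
    have h3 : PairModel.occupation β (μ k + ε) (μ k) = 1 / (Real.exp (β * ε) - 1) := by
      rw [PairModel.occupation, add_sub_cancel_left]
    rw [h3] at h2
    exact mul_le_mul_of_nonneg_left h2 (by positivity)
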